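/- Let $\tau$ be a finite set of predicate symbols with arities, let $w\ge 1$, and let $\varphi(x)$ be a formula of monadic second-order logic over $\tau$ with no free variable other than the individual variable $x$. A normalized tree decomposition of width $w$ of a finite $\tau$-structure $\mathcal A$ with domain $A$ is a finite rooted ordered tree $T$, in which every internal node has one or two children, together with a bag $(a_0,\dots,a_w)$ of pairwise distinct elements of $A$ at every node, such that: every element of $A$ occurs in some bag; for every tuple in a relation of $\mathcal A$ some bag contains all its entries; for every $a\in A$ the nodes whose bag contains $a$ induce a connected subgraph of $T$; if a node with bag $(a_0,\dots,a_w)$ has exactly one child, then the bag of the child arises from $(a_0,\dots,a_w)$ either by a permutation other than the identity or by replacing $a_0$ with a different element; and a node with two children has the same bag as both of them. Let $\tau_{td}=\tau\cup\{\mathit{root},\mathit{leaf},\mathit{child}_1,\mathit{child}_2,\mathit{bag}\}$, with arities $1,1,2,2,w+2$ for the new symbols, and let $\mathcal A_{td}$ be the $\tau_{td}$-structure with domain the disjoint union of $A$ and the node set of $T$, the relations of $\mathcal A$, and: $\mathit{root}(s)$ iff $s$ is the root; $\mathit{leaf}(s)$ iff $s$ is a leaf; $\mathit{child}_1(t,s)$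 iff $t$ is the first or only child of $s$; $\mathit{child}_2(t,s)$ iff $t$ is the second child of $s$; $\mathit{bag}(s,a_0,\dots,a_w)$ iff $(a_0,\dots,a_w)$ is the bag at $s$. A monadic datalog program over $\tau_{td}$ is a finite set of function-free rules whose head is an atom with a unary intensional predicate and whose body consists of atoms and negated atoms with (extensional) predicates in $\tau_{td}$ and of non-negated atoms with unary intensional predicates, where every variable of a rule occurs in a non-negated body atom. Over $\mathcal A_{td}$ it is evaluated by the least fixpoint of its immediate consequence operator. The program is quasi-guarded if every rule $r$ has a non-negated extensional body atom $B$ such that every variable $y$ of $r$ either occurs in $B$ or is functionally dependent on $B$, that is: for every finite $\tau$-structure $\mathcal A$ and every normalized tree decomposition of width $w$ of $\mathcal A$, any two ground instantiations of $r$ over $\mathcal A_{td}$ in which all extensional literals of the body are true and which agree on the variables of $B$ also agree on $y$. **Theorem.** There are a quasi-guarded monadic datalog program $\mathcal P$ over $\tau_{td}$ and a distinguished unary intensional predicate $p$ of $\mathcal P$, depending only on $\tau$, $w$ and $\varphi$, such that for every finite $\tau$-structure $\mathcal A$, every normalized tree decomposition of width $w$ of $\mathcal A$, and every element $d$ of the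 domain of $\mathcal A_{td}$, the atom $p(d)$ is in the least fixpoint of $\mathcal P\cup\mathcal A_{td}$ if and only if $d\in A$ and $\mathcal A\models\varphi(d)$. -/

import Mathlib

namespace MSODatalog

/-! ### Monadic second-order logic -/

/-- MSO formulas over the signature `L` with `n` individual variables and `m` set variables in
scope.  The remaining connectives and quantifiers (and `⊆`, `⊂` on set variables) are the usual
abbreviations. -/
inductive MSOFormula (L : FirstOrder.Language.{0, 0}) : ℕ → ℕ → Type
  | rel {n m r : ℕ} (R : L.Relations r) (x : Fin r → Fin n) : MSOFormula L n m
  | equal {n m : ℕ} (x y : Fin n) : MSOFormula L n m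
  | mem {n m : ℕ} (x : Fin n) (X : Fin m) : MSOFormula L n m
  | not {n m : ℕ} (φ : MSOFormula L n m) : MSOFormula L n m
  | and {n m : ℕ} (φ ψ : MSOFormula L n m) : MSOFormula L n m
  | existsElem {n m : ℕ} (φ : MSOFormula L (n + 1) m) : MSOFormula L n m
  | existsSet {n m : ℕ} (φ : MSOFormula L n (m + 1)) : MSOFormula L n m

/-- Satisfaction of an MSO formula in an `L`-structure `A`, where `v` and `V` interpret the
individual and the set variables in scope.  A quantifier binds the last variable. -/
def MSOFormula.Realize {L : FirstOrder.Language.{0, 0}} {A : Type} [L.Structure A] :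
    {n m : ℕ} → MSOFormula L n m → (Fin n → A) → (Fin m → Set A) → Prop
  | _, _, .rel R x, v, _ => FirstOrder.Language.Structure.RelMap R (fun i => v (x i))
  | _, _, .equal x y, v, _ => v x = v y
  | _, _, .mem x X, v, V => v x ∈ V X
  | _, _, .not φ, v, V => ¬ φ.Realize v V
  | _, _, .and φ ψ, v, V => φ.Realize v V ∧ ψ.Realize v V
  | _, _, .existsElem φ, v, V => ∃ a : A, φ.Realize (Fin.snoc v a) V
  | _, _, .existsSet φ, v, V => ∃ X : Set A, φ.Realize v (Fin.snoc V X)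

/-- A unary MSO query: the only variable that may be free is one individual variable. -/
abbrev UnaryQuery (L : FirstOrder.Language.{0, 0}) : Type := MSOFormula L 1 0

/-- `A ⊨ φ(a)`. -/
def UnaryQuery.Holds {L : FirstOrder.Language.{0, 0}} (φ : UnaryQuery L) {A : Type} [L.Structure A]
    (a : A) : Prop :=
  MSOFormula.Realize φ (fun _ => a) Fin.elim0

/-! ### Normalized tree decompositions -/

/-- A rooted ordered tree with set of nodes `T` in which each node has at most two children.
`first s` is the first or only child of `s`, `second s` is the second child. -/
structure RootedBinaryTree (T : Type) where
  root : T
  first : T → Option T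
  second : T → Option T
  second_eq_none : ∀ s, first s = none → second s = none
  first_ne_second : ∀ s t, first s = some t → second s ≠ some t
  root_not_child : ∀ s, first s ≠ some root ∧ second s ≠ some root
  parent_unique : ∀ s s' t, (first s = some t ∨ second s = some t) →
    (first s' = some t ∨ second s' = some t) → s = s'
  reachable : ∀ t, Relation.ReflTransGen (fun s t => first s = some t ∨ second s = some t) root t

/-- The underlying undirected graph of a tree. -/
def RootedBinaryTree.graph {T : Type} (𝒯 : RootedBinaryTree T) : SimpleGraph T :=
  SimpleGraph.fromRel (fun s t => 𝒯.first s = some t ∨ 𝒯.second s = some t)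

/-- A normalized tree decomposition of width `w` of the `L`-structure `A`, with set of nodes `T`.
Bags are tuples of `w + 1` pairwise distinct elements, so the width is exactly `w`. -/
structure NormalizedTreeDecomposition (L : FirstOrder.Language.{0, 0}) (w : ℕ) (A T : Type)
    [L.Structure A] where
  tree : RootedBinaryTree T
  bag : T → Fin (w + 1) → A
  bag_injective : ∀ s, Function.Injective (bag s)
  /-- Every element is in some bag. -/
  cover : ∀ a : A, ∃ s, a ∈ Set.range (bag s)
  /-- The entries of a tuple of a relation lie in a common bag. -/
  rel_cover : ∀ {r : ℕ} (R : L.Relations r) (u : Fin r → A), FirstOrder.Language.Structure.RelMap R u →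
    ∃ s, ∀ j, u j ∈ Set.range (bag s)
  /-- The nodes whose bag contains a given element induce a subtree. -/
  connected : ∀ a : A, (tree.graph.induce {s | a ∈ Set.range (bag s)}).Connected
  /-- A node with one child is a permutation node (for a permutation different from the identity)
  or an element replacement node. -/
  unary : ∀ s s', tree.first s = some s' → tree.second s = none →
    (∃ π : Equiv.Perm (Fin (w + 1)), π ≠ 1 ∧ ∀ i, bag s' i = bag s (π i)) ∨
    (bag s' 0 ≠ bag s 0 ∧ ∀ i, i ≠ 0 → bag s' i = bag s i)
  /-- A node with two children has the same bag as its children. -/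
  branch : ∀ s s₁ s₂, tree.first s = some s₁ → tree.second s = some s₂ →
    bag s₁ = bag s ∧ bag s₂ = bag s

/-! ### The extended signature -/

/-- The predicate symbols `L ∪ {root, leaf, child₁, child₂, bag}`, with their arities. -/
inductive TdRelation (L : FirstOrder.Language.{0, 0}) (w : ℕ) : ℕ → Type
  | base {r : ℕ} (R : L.Relations r) : TdRelation L w r
  | root : TdRelation L w 1
  | leaf : TdRelation L w 1
  | child₁ : TdRelation L w 2
  | child₂ : TdRelation L w 2
  | bag : TdRelation L w (w + 2)

/-- The extended signature, again without function symbols. -/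
def tdLanguage (L : FirstOrder.Language.{0, 0}) (w : ℕ) : FirstOrder.Language.{0, 0} where
  Functions := fun _ => Empty
  Relations := TdRelation L w

/-- The interpretation of the extended signature on the disjoint union of the elements of `A` and
the tree nodes. -/
def NormalizedTreeDecomposition.tdRelMap {L : FirstOrder.Language.{0, 0}} {w : ℕ} {A T : Type}
    [L.Structure A] (𝒯 : NormalizedTreeDecomposition L w A T) :
    {r : ℕ} → TdRelation L w r → (Fin r → A ⊕ T) → Prop
  | _, .base R, v => ∃ u, (∀ j, v j = Sum.inl (u j)) ∧ FirstOrder.Language.Structure.RelMap R u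
  | _, .root, v => v 0 = Sum.inr 𝒯.tree.root
  | _, .leaf, v => ∃ s, v 0 = Sum.inr s ∧ 𝒯.tree.first s = none
  | _, .child₁, v => ∃ t s, v 0 = Sum.inr t ∧ v 1 = Sum.inr s ∧ 𝒯.tree.first s = some t
  | _, .child₂, v => ∃ t s, v 0 = Sum.inr t ∧ v 1 = Sum.inr s ∧ 𝒯.tree.second s = some t
  | _, .bag, v => ∃ s, v 0 = Sum.inr s ∧ ∀ i : Fin (w + 1), v i.succ = Sum.inl (𝒯.bag s i)

/-- The structure that represents `A` together with its tree decomposition. -/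
@[reducible]
def NormalizedTreeDecomposition.tdStructure {L : FirstOrder.Language.{0, 0}} {w : ℕ} {A T : Type}
    [L.Structure A] (𝒯 : NormalizedTreeDecomposition L w A T) :
    (tdLanguage L w).Structure (A ⊕ T) where
  funMap := fun f => Empty.elim f
  RelMap := fun R v => 𝒯.tdRelMap R v

/-! ### Monadic datalog -/

/-- An atom `R(x₁, …, x_r)` with an extensional predicate from `E`; variables are natural
numbers. -/
structure ExtAtom (E : FirstOrder.Language.{0, 0}) where
  arity : ℕ
  rel : E.Relations arity
  args : Fin arity → ℕ

/-- The variables of an atom. -/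
def ExtAtom.vars {E : FirstOrder.Language.{0, 0}} (B : ExtAtom E) : Set ℕ := Set.range B.args

/-- The truth of the ground instance of an atom under the substitution `σ`. -/
def ExtAtom.Holds {E : FirstOrder.Language.{0, 0}} {D : Type} (S : E.Structure D) (B : ExtAtom E)
    (σ : ℕ → D) : Prop :=
  S.RelMap B.rel (fun i => σ (B.args i))

/-- A rule of monadic datalog with extensional predicates from `E`.  Intensional predicates are
unary and named by natural numbers; `(p, x)` stands for the intensional atom `p(x)`.  The body
consists of positive and negated extensional atoms and of intensional atoms. -/
structure MonadicRule (E : FirstOrder.Language.{0, 0}) where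
  head : ℕ × ℕ
  posExt : List (ExtAtom E)
  negExt : List (ExtAtom E)
  intensional : List (ℕ × ℕ)

/-- A monadic datalog program: a finite list of rules. -/
abbrev MonadicProgram (E : FirstOrder.Language.{0, 0}) : Type := List (MonadicRule E)

/-- The variables of a rule. -/
def MonadicRule.vars {E : FirstOrder.Language.{0, 0}} (r : MonadicRule E) : Set ℕ :=
  {y | y = r.head.2 ∨ (∃ B ∈ r.posExt, y ∈ B.vars) ∨ (∃ B ∈ r.negExt, y ∈ B.vars) ∨
    ∃ q ∈ r.intensional, y = q.2}

/-- Every variable of the rule occurs in a positive body atom. -/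
def MonadicRule.IsSafe {E : FirstOrder.Language.{0, 0}} (r : MonadicRule E) : Prop :=
  ∀ y ∈ r.vars, (∃ B ∈ r.posExt, y ∈ B.vars) ∨ ∃ q ∈ r.intensional, y = q.2

/-- The extensional part of the body is true under the substitution `σ`. -/
def MonadicRule.ExtBodyHolds {E : FirstOrder.Language.{0, 0}} {D : Type} (S : E.Structure D)
    (r : MonadicRule E) (σ : ℕ → D) : Prop :=
  (∀ B ∈ r.posExt, B.Holds S σ) ∧ ∀ B ∈ r.negExt, ¬ B.Holds S σ

/-- The immediate consequence operator of a program over the structure `S`, on sets of ground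
intensional atoms. -/
def immediateConsequence {E : FirstOrder.Language.{0, 0}} {D : Type} (P : MonadicProgram E)
    (S : E.Structure D) : Set (ℕ × D) →o Set (ℕ × D) where
  toFun I := {f | ∃ r ∈ P, ∃ σ : ℕ → D, r.ExtBodyHolds S σ ∧
    (∀ q ∈ r.intensional, (q.1, σ q.2) ∈ I) ∧ f = (r.head.1, σ r.head.2)}
  monotone' := by
    rintro I J hIJ f ⟨r, hr, σ, hE, hI, hf⟩
    exact ⟨r, hr, σ, hE, fun q hq => hIJ (hI q hq), hf⟩

/-- The intensional part of the least fixpoint of the program over the structure `S`. -/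
def leastFixpoint {E : FirstOrder.Language.{0, 0}} {D : Type} (P : MonadicProgram E)
    (S : E.Structure D) : Set (ℕ × D) :=
  (immediateConsequence P S).lfp

/-- The variable `y` of `r` is functionally dependent on the atom `B`: over every structure
representing a finite `L`-structure with a normalized tree decomposition of width `w`, the value
of `B` determines the value of `y` in the ground instances of `r` whose extensional literals are
true. -/
def FunctionallyDependent {L : FirstOrder.Language.{0, 0}} {w : ℕ} (r : MonadicRule (tdLanguage L w))
    (B : ExtAtom (tdLanguage L w)) (y : ℕ) : Prop :=
  ∀ (A T : Type) [Finite A] [Finite T] [L.Structure A]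
    (𝒯 : NormalizedTreeDecomposition L w A T) (σ σ' : ℕ → A ⊕ T),
    r.ExtBodyHolds 𝒯.tdStructure σ → r.ExtBodyHolds 𝒯.tdStructure σ' →
    (∀ x ∈ B.vars, σ x = σ' x) → σ y = σ' y

/-- Every rule has a quasi-guard: a positive extensional body atom `B` such that each variable of
the rule occurs in `B` or is functionally dependent on `B`. -/
def IsQuasiGuarded {L : FirstOrder.Language.{0, 0}} {w : ℕ} (P : MonadicProgram (tdLanguage L w)) : Prop :=
  ∀ r ∈ P, ∃ B ∈ r.posExt, ∀ y ∈ r.vars, y ∈ B.vars ∨ FunctionallyDependent r B y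

end MSODatalog

open MSODatalog

/-! The proof passes through nondeterministic tree automata. The letter at a node records which
relations hold among the bag positions, which positions agree with positions in the children's bags,
and which positions carry elements of given sets. Since `L` has finitely many relation symbols, this
data ranges over a finite set.

Recognizability of MSO follows Büchi's pattern. Negation uses the subset automaton, and conjunction
the product. A set quantifier is handled by guessing a marking of each bag: markings that agree
along tree edges come from a set, because the nodes containing a given element are connected
(`exists_marking_eq`). Elements are singletons, and atoms are settled by searching for one bag,
which suffices since bags cover all elements and related tuples. For φ(x), the automaton also
guesses {x} and keeps the marking in its state, so answers can be read off accepting runs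
(`UnaryQuery.exists_treeAutomaton`).

The program simulates the automaton in two sweeps: `up q` holds at a node if some run on its subtree
has state `q` there, and `down q` if some accepting run on the whole tree does. The second sweep is
sound because runs on child subtrees can be exchanged (`exists_glue`). Rule bodies recover the
letter from the signature (`BodyHolds.exists_matches`); the bag atom of the node is the quasi-guard,
since a node determines its children and their bags. -/

namespace MSODatalog

/-! ### Trees -/

namespace RootedBinaryTree

variable {T : Type} (𝒯 : RootedBinaryTree T)

/-- The first (`false`) and the second (`true`) child of a node. -/
def child (s : T) : Bool → Option T
  | false => 𝒯.first s
  | true => 𝒯.second s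

/-- `t` is `s` or a descendant of `s`. -/
def Below (s t : T) : Prop :=
  Relation.ReflTransGen (fun s t => ∃ b, 𝒯.child s b = some t) s t

variable {𝒯}

theorem exists_child_iff {s t : T} :
    (∃ b, 𝒯.child s b = some t) ↔ 𝒯.first s = some t ∨ 𝒯.second s = some t := by
  simp [child]

theorem parent_eq {s s' t : T} {b b' : Bool} (h : 𝒯.child s b = some t)
    (h' : 𝒯.child s' b' = some t) : s = s' :=
  𝒯.parent_unique s s' t (exists_child_iff.1 ⟨b, h⟩) (exists_child_iff.1 ⟨b', h'⟩)

theorem side_eq {s t : T} {b b' : Bool} (h : 𝒯.child s b = some t)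
    (h' : 𝒯.child s b' = some t) : b = b' := by
  have := 𝒯.first_ne_second s t
  cases b <;> cases b' <;> simp_all [child]

theorem child_ne_root {s : T} {b : Bool} : 𝒯.child s b ≠ some 𝒯.root := by
  cases b
  · exact (𝒯.root_not_child s).1
  · exact (𝒯.root_not_child s).2

theorem root_below (t : T) : 𝒯.Below 𝒯.root t :=
  Relation.ReflTransGen.mono (fun _ _ h => exists_child_iff.2 h) _ _ (𝒯.reachable t)

theorem topDown {p : T → Prop} (h₀ : p 𝒯.root)
    (h : ∀ s b t, 𝒯.child s b = some t → p s → p t) (t : T) : p t := by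
  induction root_below (𝒯 := 𝒯) t with
  | refl => exact h₀
  | tail _ hc ih =>
    obtain ⟨b, hb⟩ := hc
    exact h _ b _ hb ih

/-- By induction from the root: the root has no parent, and a cycle through a child passes through
its unique parent, giving a cycle there. -/
theorem not_transGen_self (t : T) :
    ¬ Relation.TransGen (fun s t => ∃ b, 𝒯.child s b = some t) t t := by
  refine topDown (𝒯 := 𝒯) (p := fun t => ¬ Relation.TransGen _ t t) ?_ ?_ t
  · intro h
    obtain ⟨c, -, b, hb⟩ := Relation.TransGen.tail'_iff.1 h
    exact child_ne_root hb
  · intro s b t hb hs h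
    obtain ⟨c, hc, b', hb'⟩ := Relation.TransGen.tail'_iff.1 h
    obtain rfl := parent_eq hb hb'
    exact hs (Relation.TransGen.head' ⟨b, hb⟩ hc)

/-- Strict descent is transitive and irreflexive, hence well-founded on a finite tree. -/
theorem bottomUp [Finite T] {p : T → Prop}
    (h : ∀ s, (∀ b t, 𝒯.child s b = some t → p t) → p s) (s : T) : p s := by
  have : IsTrans T (fun t s => Relation.TransGen (fun s t => ∃ b, 𝒯.child s b = some t) s t) :=
    ⟨fun _ _ _ hab hbc => hbc.trans hab⟩
  have : Std.Irrefl
      (fun t s => Relation.TransGen (fun s t => ∃ b, 𝒯.child s b = some t) s t) :=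
    ⟨not_transGen_self⟩
  have wf := Finite.wellFounded_of_trans_of_irrefl
    (fun t s => Relation.TransGen (fun s t => ∃ b, 𝒯.child s b = some t) s t)
  induction s using wf.induction with
  | _ s ih => exact h s fun b t hb => ih t (.single ⟨b, hb⟩)

theorem not_below_of_child {s c : T} {b : Bool} (h : 𝒯.child s b = some c) : ¬ 𝒯.Below c s :=
  fun h' => not_transGen_self s (Relation.TransGen.head' ⟨b, h⟩ h')

/-- Parents are unique, so the ancestors of `t` form a chain; two distinct siblings cannot be
comparable, as one would then lie above their parent. -/
theorem below_child_unique {s c c' t : T} {b b' : Bool} (h : 𝒯.child s b = some c)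
    (h' : 𝒯.child s b' = some c') (hc : 𝒯.Below c t) (hc' : 𝒯.Below c' t) : b = b' := by
  have key : ∀ {c c' : T} {b b' : Bool}, 𝒯.child s b = some c → 𝒯.child s b' = some c' →
      𝒯.Below c c' → b = b' := by
    intro c c' b b' h h' hb
    rcases Relation.ReflTransGen.cases_tail hb with rfl | ⟨d, hd, b'', hb''⟩
    · exact side_eq h h'
    · obtain rfl := parent_eq h' hb''
      exact absurd hd (not_below_of_child h)
  have hu : Relator.RightUnique (Function.swap fun s t => ∃ b, 𝒯.child s b = some t) := by
    rintro x y z ⟨_, hy⟩ ⟨_, hz⟩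
    exact parent_eq hy hz
  rcases Relation.ReflTransGen.total_of_right_unique hu (Relation.reflTransGen_swap.2 hc)
    (Relation.reflTransGen_swap.2 hc') with h₁ | h₁
  · exact (key h' h (Relation.reflTransGen_swap.1 h₁)).symm
  · exact key h h' (Relation.reflTransGen_swap.1 h₁)

end RootedBinaryTree

/-! ### Tree automata -/

/-- A nondeterministic automaton on trees with labels from `Λ`. -/
structure TreeAutomaton (Λ : Type) where
  State : Type
  step : Λ → State → (Bool → Option State) → Prop
  final : State → Prop

namespace TreeAutomaton

variable {Λ : Type} (N : TreeAutomaton Λ) {T : Type} (𝒯 : RootedBinaryTree T) (l : T → Λ)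

/-- The local condition on a run at a node. -/
def RunAt (ρ : T → N.State) (s : T) : Prop :=
  N.step (l s) (ρ s) fun b => (𝒯.child s b).map ρ

/-- An accepting run. -/
def IsAccepting (ρ : T → N.State) : Prop :=
  (∀ s, N.RunAt 𝒯 l ρ s) ∧ N.final (ρ 𝒯.root)

def Accepts : Prop := ∃ ρ, N.IsAccepting 𝒯 l ρ

/-- The states that a run on the subtree at `s` can have at `s`. -/
def attainable (s : T) : Set N.State :=
  {q | ∃ ρ, ρ s = q ∧ ∀ t, 𝒯.Below s t → N.RunAt 𝒯 l ρ t}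

variable {N 𝒯 l}

open RootedBinaryTree

/-- Runs on the subtrees at the children of `s` can replace the corresponding part of `ρ`. -/
theorem exists_glue {s : T} {ρ : T → N.State} {o : Bool → Option N.State}
    (hs : N.step (l s) (ρ s) o) (hn : ∀ b, 𝒯.child s b = none → o b = none)
    (hc : ∀ b c, 𝒯.child s b = some c → ∃ q ∈ N.attainable 𝒯 l c, o b = some q) :
    ∃ ρ' : T → N.State, ρ' s = ρ s ∧ ρ' 𝒯.root = ρ 𝒯.root ∧
      (∀ b, (𝒯.child s b).map ρ' = o b) ∧ (∀ t, 𝒯.Below s t → N.RunAt 𝒯 l ρ' t) ∧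
      ∀ t, N.RunAt 𝒯 l ρ t → N.RunAt 𝒯 l ρ' t := by
  classical
  have hσ : ∀ b, ∃ σ : T → N.State, ∀ c, 𝒯.child s b = some c →
      o b = some (σ c) ∧ ∀ t, 𝒯.Below c t → N.RunAt 𝒯 l σ t := by
    intro b
    cases h : 𝒯.child s b with
    | none => exact ⟨ρ, by simp⟩
    | some c =>
      obtain ⟨q, ⟨σ, rfl, hσ⟩, hq⟩ := hc b c h
      refine ⟨σ, fun c' hc' => ?_⟩
      cases hc'
      exact ⟨hq, hσ⟩
  choose σ hσ using hσ
  -- The chosen side is irrelevant: by `below_child_unique` a node lies below at most one child of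
  -- `s`.
  set ρ' : T → N.State := fun t =>
    if h : ∃ b c, 𝒯.child s b = some c ∧ 𝒯.Below c t then σ h.choose t else ρ t with hρ'
  have h₁ : ∀ {b c t}, 𝒯.child s b = some c → 𝒯.Below c t → ρ' t = σ b t := by
    intro b c t hb ht
    have h : ∃ b c, 𝒯.child s b = some c ∧ 𝒯.Below c t := ⟨b, c, hb, ht⟩
    obtain ⟨c', hc', ht'⟩ := h.choose_spec
    have := below_child_unique hb hc' ht ht'
    simp only [hρ', dif_pos h, ← this]
  have h₂ : ∀ {t}, (¬ ∃ b c, 𝒯.child s b = some c ∧ 𝒯.Below c t) → ρ' t = ρ t := by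
    intro t h
    simp only [hρ', dif_neg h]
  have hss : ρ' s = ρ s := h₂ fun ⟨b, c, hb, hcs⟩ => not_below_of_child hb hcs
  have hmap : ∀ b, (𝒯.child s b).map ρ' = o b := by
    intro b
    cases h : 𝒯.child s b with
    | none => simp [hn b h]
    | some c => simp [h₁ h Relation.ReflTransGen.refl, (hσ b c h).1]
  have hrs : N.RunAt 𝒯 l ρ' s := by
    have : (fun b => (𝒯.child s b).map ρ') = o := funext hmap
    simpa only [RunAt, this, hss] using hs
  have hrc : ∀ {b c t}, 𝒯.child s b = some c → 𝒯.Below c t → N.RunAt 𝒯 l ρ' t := by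
    intro b c t hb ht
    have : (fun b' => (𝒯.child t b').map ρ') = fun b' => (𝒯.child t b').map (σ b) := by
      funext b'
      cases h : 𝒯.child t b' with
      | none => rfl
      | some d => simp [h₁ hb (ht.tail ⟨b', h⟩)]
    simpa only [RunAt, this, h₁ hb ht] using (hσ b c hb).2 t ht
  refine ⟨ρ', hss, h₂ ?_, hmap, ?_, ?_⟩
  · rintro ⟨b, c, hb, hr⟩
    rcases Relation.ReflTransGen.cases_tail hr with h | ⟨d, -, b', hb'⟩
    · exact child_ne_root (h ▸ hb)
    · exact child_ne_root hb'
  · intro t ht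
    rcases Relation.ReflTransGen.cases_head ht with rfl | ⟨c, ⟨b, hb⟩, hct⟩
    · exact hrs
    · exact hrc hb hct
  · intro t ht
    by_cases h : ∃ b c, 𝒯.child s b = some c ∧ 𝒯.Below c t
    · obtain ⟨b, c, hb, hct⟩ := h
      exact hrc hb hct
    by_cases hts : t = s
    · exact hts ▸ hrs
    -- Away from `s` and its descendants nothing changes: a child of `t` below a child of `s` would
    -- force `t = s` or put `t` below that child.
    have : (fun b => (𝒯.child t b).map ρ') = fun b => (𝒯.child t b).map ρ := by
      funext b
      cases hd : 𝒯.child t b with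
      | none => rfl
      | some d =>
        simp only [Option.map_some, Option.some.injEq]
        refine h₂ ?_
        rintro ⟨b', c, hb', hcd⟩
        rcases Relation.ReflTransGen.cases_tail hcd with rfl | ⟨e, he, b'', hb''⟩
        · exact hts (parent_eq hd hb')
        · obtain rfl := parent_eq hd hb''
          exact h ⟨b', c, hb', he⟩
    simpa only [RunAt, this, h₂ h] using ht

variable (N 𝒯 l) in
-- Attainable states obey a local recursion, since runs on the child subtrees can be chosen
-- independently. The subset automaton and the `up` rules both rest on this.
theorem mem_attainable_iff (s : T) (q : N.State) :
    q ∈ N.attainable 𝒯 l s ↔ ∃ o, N.step (l s) q o ∧ ∀ b,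
      (𝒯.child s b = none → o b = none) ∧
      ∀ c, 𝒯.child s b = some c → ∃ q' ∈ N.attainable 𝒯 l c, o b = some q' := by
  constructor
  · rintro ⟨ρ, rfl, hρ⟩
    refine ⟨_, hρ s .refl, fun b => ⟨fun h => by simp [h], fun c hc => ?_⟩⟩
    exact ⟨ρ c, ⟨ρ, rfl, fun t ht => hρ t (.head ⟨b, hc⟩ ht)⟩, by simp [hc]⟩
  · rintro ⟨o, hq, ho⟩
    obtain ⟨ρ', h, -, -, h', -⟩ := exists_glue (𝒯 := 𝒯) (ρ := fun _ => q) hq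
      (fun b => (ho b).1) fun b => (ho b).2
    exact ⟨ρ', h, h'⟩

variable (N 𝒯 l) in
theorem accepts_iff_attainable :
    N.Accepts 𝒯 l ↔ ∃ q ∈ N.attainable 𝒯 l 𝒯.root, N.final q := by
  constructor
  · rintro ⟨ρ, h, hf⟩
    exact ⟨_, ⟨ρ, rfl, fun t _ => h t⟩, hf⟩
  · rintro ⟨_, ⟨ρ, rfl, h⟩, hf⟩
    exact ⟨ρ, fun s => h s (root_below s), hf⟩

/-- The subset automaton, accepting the complement. -/
def compl (N : TreeAutomaton Λ) : TreeAutomaton Λ where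
  State := Set N.State
  step a S o := S = {q | ∃ o', N.step a q o' ∧ ∀ b, (o b = none → o' b = none) ∧
    ∀ S', o b = some S' → ∃ q' ∈ S', o' b = some q'}
  final S := ∀ q ∈ S, ¬ N.final q

theorem compl_runAt_iff (ρ : T → Set N.State) (s : T) :
    N.compl.RunAt 𝒯 l ρ s ↔ ρ s = {q | ∃ o, N.step (l s) q o ∧ ∀ b,
      (𝒯.child s b = none → o b = none) ∧
      ∀ c, 𝒯.child s b = some c → ∃ q' ∈ ρ c, o b = some q'} := by
  simp [RunAt, compl]

/-- The subset automaton is deterministic from the leaves upward: its only run is `N.attainable 𝒯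
l`. -/
theorem compl_accepts_iff [Finite T] : N.compl.Accepts 𝒯 l ↔ ¬ N.Accepts 𝒯 l := by
  rw [accepts_iff_attainable N]
  constructor
  · rintro ⟨ρ, h, hf⟩
    change T → Set N.State at ρ
    have : ∀ s, ρ s = N.attainable 𝒯 l s := by
      refine bottomUp (𝒯 := 𝒯) fun s ih => ?_
      rw [(compl_runAt_iff ρ s).1 (h s)]
      ext q
      rw [mem_attainable_iff, Set.mem_ofPred_eq]
      refine exists_congr fun o => and_congr_right fun _ => forall_congr' fun b =>
        and_congr_right fun _ => forall_congr' fun c => forall_congr' fun hc => ?_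
      rw [ih b c hc]
    rintro ⟨q, hq, hqf⟩
    exact hf q (by rwa [this]) hqf
  · intro h
    refine ⟨N.attainable 𝒯 l, fun s => ?_, fun q hq hf => h ⟨q, hq, hf⟩⟩
    rw [compl_runAt_iff]
    ext q
    exact mem_attainable_iff N 𝒯 l s q

/-- The product automaton. -/
def prod (N N' : TreeAutomaton Λ) : TreeAutomaton Λ where
  State := N.State × N'.State
  step a q o := N.step a q.1 (fun b => (o b).map Prod.fst) ∧
    N'.step a q.2 fun b => (o b).map Prod.snd
  final q := N.final q.1 ∧ N'.final q.2

theorem prod_runAt_iff {N' : TreeAutomaton Λ} (ρ : T → N.State) (ρ' : T → N'.State) (s : T) :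
    (N.prod N').RunAt 𝒯 l (fun s => (ρ s, ρ' s)) s ↔ N.RunAt 𝒯 l ρ s ∧ N'.RunAt 𝒯 l ρ' s := by
  have h : (fun b => ((𝒯.child s b).map fun s => (ρ s, ρ' s)).map Prod.fst) =
      fun b => (𝒯.child s b).map ρ := by simp [Function.comp_def]
  have h' : (fun b => ((𝒯.child s b).map fun s => (ρ s, ρ' s)).map Prod.snd) =
      fun b => (𝒯.child s b).map ρ' := by simp [Function.comp_def]
  unfold RunAt
  rw [← h, ← h']
  rfl

theorem prod_accepts_iff {N' : TreeAutomaton Λ} :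
    (N.prod N').Accepts 𝒯 l ↔ N.Accepts 𝒯 l ∧ N'.Accepts 𝒯 l := by
  constructor
  · rintro ⟨ρ, h, hf⟩
    have h := fun s => (prod_runAt_iff (fun s => (ρ s).1) (fun s => (ρ s).2) s).1 (h s)
    exact ⟨⟨_, fun s => (h s).1, hf.1⟩, ⟨_, fun s => (h s).2, hf.2⟩⟩
  · rintro ⟨⟨ρ, h, hf⟩, ⟨ρ', h', hf'⟩⟩
    exact ⟨fun s => (ρ s, ρ' s), fun s => (prod_runAt_iff ρ ρ' s).2 ⟨h s, h' s⟩, hf, hf'⟩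

/-- The automaton that looks for a node whose label satisfies `D`. -/
def search (D : Λ → Prop) : TreeAutomaton Λ where
  State := Prop
  step a q o := q → D a ∨ ∃ b q', o b = some q' ∧ q'
  final q := q

theorem search_accepts_iff [Finite T] {D : Λ → Prop} :
    (search D).Accepts 𝒯 l ↔ ∃ s, D (l s) := by
  constructor
  · rintro ⟨ρ, h, hf⟩
    by_contra hD
    have : ∀ s, ¬ ρ s := by
      refine bottomUp (𝒯 := 𝒯) fun s ih hs => ?_
      rcases h s hs with h' | ⟨b, q', hb, hq'⟩
      · exact hD ⟨s, h'⟩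
      · obtain ⟨t, ht, rfl⟩ := Option.map_eq_some_iff.1 hb
        exact ih b t ht hq'
    exact this _ hf
  · rintro ⟨s, hs⟩
    -- The run is true exactly on the path from the root to `s`.
    refine ⟨fun t => 𝒯.Below t s, fun t ht => ?_, root_below s⟩
    rcases Relation.ReflTransGen.cases_head ht with rfl | ⟨c, ⟨b, hb⟩, hc⟩
    · exact .inl hs
    · exact .inr ⟨b, 𝒯.Below c s, congrArg (Option.map _) hb, hc⟩

/-- Relabelling. -/
def comap {Λ' : Type} (f : Λ' → Λ) (N : TreeAutomaton Λ) : TreeAutomaton Λ' where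
  State := N.State
  step a := N.step (f a)
  final := N.final

end TreeAutomaton

/-! ### Recognizable queries -/

variable {L : FirstOrder.Language.{0, 0}} {w : ℕ} {ι κ : Type}

/-- The atomic facts that can hold in a bag: a relation symbol with a tuple of positions. -/
abbrev BagFact (L : FirstOrder.Language.{0, 0}) (w : ℕ) : Type :=
  Σ R : (Σ r, L.Relations r), Fin R.1 → Fin (w + 1)

/-- What an automaton reads at a node of a tree decomposition with sets marked by `ι`: the
relations in the bag, the pairs of equal positions in the bag and the bag of each child, and the
positions of the elements of the marked sets. -/
@[ext]
structure Letter (L : FirstOrder.Language.{0, 0}) (w : ℕ) (ι : Type) where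
  facts : Set (BagFact L w)
  edge : Bool → Set (Fin (w + 1) × Fin (w + 1))
  marks : ι → Set (Fin (w + 1))

namespace Letter

/-- The letter with an additional marked set. -/
def extend (a : Letter L w ι) (M : Set (Fin (w + 1))) : Letter L w (Option ι) where
  facts := a.facts
  edge := a.edge
  marks k := k.elim M a.marks

def reindex (f : κ → ι) (a : Letter L w ι) : Letter L w κ where
  facts := a.facts
  edge := a.edge
  marks k := a.marks (f k)

end Letter

/-! ### Letters of a decomposition and markings of sets -/

namespace NormalizedTreeDecomposition

variable {A T : Type} [L.Structure A] (𝒯 : NormalizedTreeDecomposition L w A T)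

/-- The positions in the bag at `s` of the elements of `X`. -/
def marking (X : Set A) (s : T) : Set (Fin (w + 1)) := {i | 𝒯.bag s i ∈ X}

/-- The relations in the bag at `s`. -/
def bagFacts (s : T) : Set (BagFact L w) :=
  {x | FirstOrder.Language.Structure.RelMap x.1.2 fun j => 𝒯.bag s (x.2 j)}

/-- The equality pattern between the bag at `s` and the bag at a child. -/
def bagEdge (s : T) (b : Bool) : Set (Fin (w + 1) × Fin (w + 1)) :=
  {p | ∃ t, 𝒯.tree.child s b = some t ∧ 𝒯.bag s p.1 = 𝒯.bag t p.2}

/-- The letter at a node. -/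
def letter (V : ι → Set A) (s : T) : Letter L w ι where
  facts := 𝒯.bagFacts s
  edge := 𝒯.bagEdge s
  marks k := 𝒯.marking (V k) s

theorem letter_extend (V : ι → Set A) (X : Set A) (s : T) :
    𝒯.letter (fun k : Option ι => k.elim X V) s = (𝒯.letter V s).extend (𝒯.marking X s) := by
  ext1
  · rfl
  · rfl
  · funext k
    cases k <;> rfl

/-- Markings of the bags that agree along the edges of the tree are the markings of a set. -/
theorem exists_marking_eq {M : T → Set (Fin (w + 1))}
    (hM : ∀ s b t, 𝒯.tree.child s b = some t → ∀ i j, 𝒯.bag s i = 𝒯.bag t j →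
      (i ∈ M s ↔ j ∈ M t)) :
    ∃ X : Set A, ∀ s, 𝒯.marking X s = M s := by
  have key : ∀ a s t i j, 𝒯.bag s i = a → 𝒯.bag t j = a → i ∈ M s → j ∈ M t := by
    intro a s t i j hi hj his
    obtain ⟨W⟩ := (𝒯.connected a).preconnected ⟨s, i, hi⟩ ⟨t, j, hj⟩
    suffices h : ∀ (u v : {s | a ∈ Set.range (𝒯.bag s)})
        (_ : (𝒯.tree.graph.induce {s | a ∈ Set.range (𝒯.bag s)}).Walk u v),
        ∀ i j, 𝒯.bag u i = a → 𝒯.bag v j = a → i ∈ M u → j ∈ M v from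
      h _ _ W i j hi hj his
    intro u v W
    induction W with
    | nil =>
      intro i j hi hj h
      rwa [𝒯.bag_injective _ (hj.trans hi.symm)]
    | @cons u v x huv _ ih =>
      intro i j hi hj h
      obtain ⟨k, hk⟩ := v.2
      refine ih k j hk hj ?_
      -- A step of the walk goes down or up a tree edge; the hypothesis is an equivalence, so it
      -- serves both directions.
      obtain ⟨-, h' | h'⟩ := (SimpleGraph.fromRel_adj _ _ _).1
        (show (SimpleGraph.fromRel fun s t => 𝒯.tree.first s = some t ∨
          𝒯.tree.second s = some t).Adj u.1 v.1 from huv)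
      · obtain ⟨b, hb⟩ := RootedBinaryTree.exists_child_iff.2 h'
        exact (hM _ b _ hb i k (hi.trans hk.symm)).1 h
      · obtain ⟨b, hb⟩ := RootedBinaryTree.exists_child_iff.2 h'
        exact (hM _ b _ hb k i (hk.trans hi.symm)).2 h
  refine ⟨{a | ∃ s i, 𝒯.bag s i = a ∧ i ∈ M s}, fun t => ?_⟩
  ext j
  exact ⟨fun ⟨s, i, h, hi⟩ => key _ s t i j h rfl hi, fun h => ⟨t, j, rfl, h⟩⟩

end NormalizedTreeDecomposition

namespace TreeAutomaton

/-- The automaton that guesses the marking of an additional set. -/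
def guess (N : TreeAutomaton (Letter L w (Option ι))) : TreeAutomaton (Letter L w ι) where
  State := N.State × Set (Fin (w + 1))
  step a q o := N.step (a.extend q.2) q.1 (fun b => (o b).map Prod.fst) ∧
    ∀ b q', o b = some q' → ∀ p ∈ a.edge b, p.1 ∈ q.2 ↔ p.2 ∈ q'.2
  final q := N.final q.1

variable {A T : Type} [L.Structure A] {𝒯 : NormalizedTreeDecomposition L w A T}
  {N : TreeAutomaton (Letter L w (Option ι))} {V : ι → Set A}

/-- The second conjunct is the consistency condition of `exists_marking_eq`, which the automaton can
check because equal positions are part of the letter. -/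
theorem guess_runAt_iff (ρ : T → N.State) (M : T → Set (Fin (w + 1))) (s : T) :
    N.guess.RunAt 𝒯.tree (𝒯.letter V) (fun s => (ρ s, M s)) s ↔
      N.RunAt 𝒯.tree (fun s => (𝒯.letter V s).extend (M s)) ρ s ∧
      ∀ b t, 𝒯.tree.child s b = some t → ∀ i j, 𝒯.bag s i = 𝒯.bag t j → (i ∈ M s ↔ j ∈ M t) := by
  have h : (fun b => ((𝒯.tree.child s b).map fun s => (ρ s, M s)).map Prod.fst) =
      fun b => (𝒯.tree.child s b).map ρ := by simp [Function.comp_def]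
  refine and_congr (by unfold RunAt; rw [← h]; rfl) ?_
  refine forall_congr' fun b => ⟨fun H t ht i j hij => ?_, fun H q' hq' p hp => ?_⟩
  · exact H (ρ t, M t) (congrArg (Option.map _) ht) (i, j) ⟨t, ht, hij⟩
  · obtain ⟨t, ht, rfl⟩ := Option.map_eq_some_iff.1 hq'
    obtain ⟨t', ht', hp⟩ := hp
    obtain rfl := Option.some.inj (ht.symm.trans ht')
    exact H t ht p.1 p.2 hp

/-- The guessed markings are consistent along edges, hence the trace of a single set on all bags. -/
theorem exists_of_guess_isAccepting {ρ : T → N.guess.State}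
    (h : N.guess.IsAccepting 𝒯.tree (𝒯.letter V) ρ) :
    ∃ X : Set A, (∀ s, (ρ s).2 = 𝒯.marking X s) ∧
      N.Accepts 𝒯.tree (𝒯.letter fun k : Option ι => k.elim X V) := by
  have h₁ := fun s => (guess_runAt_iff (fun s => (ρ s).1) (fun s => (ρ s).2) s).1 (h.1 s)
  obtain ⟨X, hX⟩ := 𝒯.exists_marking_eq fun s => (h₁ s).2
  refine ⟨X, fun s => (hX s).symm, fun s => (ρ s).1, fun s => ?_, h.2⟩
  have : 𝒯.letter (fun k : Option ι => k.elim X V) =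
      fun s => (𝒯.letter V s).extend (ρ s).2 := by
    funext s
    rw [𝒯.letter_extend, hX]
  rw [this]
  exact (h₁ s).1

theorem exists_guess_isAccepting {X : Set A}
    (h : N.Accepts 𝒯.tree (𝒯.letter fun k : Option ι => k.elim X V)) :
    ∃ ρ, N.guess.IsAccepting 𝒯.tree (𝒯.letter V) ρ ∧ ∀ s, (ρ s).2 = 𝒯.marking X s := by
  obtain ⟨ρ, h, hf⟩ := h
  refine ⟨fun s => (ρ s, 𝒯.marking X s), ⟨fun s => ?_, hf⟩, fun _ => rfl⟩
  refine (guess_runAt_iff ρ (𝒯.marking X) s).2 ⟨?_, fun b t _ i j hij => ?_⟩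
  · have := h s
    rwa [show 𝒯.letter (fun k : Option ι => k.elim X V) = _ from
      funext (𝒯.letter_extend V X)] at this
  · simp only [NormalizedTreeDecomposition.marking, Set.mem_ofPred_eq, hij]

end TreeAutomaton

/-- A query on tuples of sets in `L`-structures is recognizable if a finite automaton on
tree decompositions of width `w` decides it. -/
def Recognizable (L : FirstOrder.Language.{0, 0}) (w : ℕ)
    (P : ∀ A : Type, [L.Structure A] → (ι → Set A) → Prop) : Prop :=
  ∃ N : TreeAutomaton (Letter L w ι), Finite N.State ∧
    ∀ (A T : Type) [Finite T] [L.Structure A] (𝒯 : NormalizedTreeDecomposition L w A T)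
      (V : ι → Set A), N.Accepts 𝒯.tree (𝒯.letter V) ↔ P A V

/-! ### Closure properties and atomic recognizable queries -/

namespace Recognizable

variable {P Q : ∀ A : Type, [L.Structure A] → (ι → Set A) → Prop}

theorem not (h : Recognizable L w P) : Recognizable L w (fun A _ V => ¬ P A V) := by
  obtain ⟨N, hN, h⟩ := h
  refine ⟨N.compl, inferInstanceAs (Finite (Set N.State)), fun A T _ _ 𝒯 V => ?_⟩
  rw [TreeAutomaton.compl_accepts_iff, h]

theorem and (h : Recognizable L w P) (h' : Recognizable L w Q) :
    Recognizable L w (fun A _ V => P A V ∧ Q A V) := by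
  obtain ⟨N, hN, h⟩ := h
  obtain ⟨N', hN', h'⟩ := h'
  refine ⟨N.prod N', inferInstanceAs (Finite (N.State × N'.State)), fun A T _ _ 𝒯 V => ?_⟩
  rw [TreeAutomaton.prod_accepts_iff, h, h']

theorem existsSet {P : ∀ A : Type, [L.Structure A] → (Option ι → Set A) → Prop}
    (h : Recognizable L w P) :
    Recognizable L w (fun A _ (V : ι → Set A) => ∃ X, P A (fun k : Option ι => k.elim X V)) := by
  obtain ⟨N, hN, h⟩ := h
  refine ⟨N.guess, inferInstanceAs (Finite (N.State × Set (Fin (w + 1)))),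
    fun A T _ _ 𝒯 V => ⟨fun ⟨ρ, hρ⟩ => ?_, fun ⟨X, hX⟩ => ?_⟩⟩
  · obtain ⟨X, -, hX⟩ := TreeAutomaton.exists_of_guess_isAccepting hρ
    exact ⟨X, (h A T 𝒯 _).1 hX⟩
  · obtain ⟨ρ, hρ, -⟩ := TreeAutomaton.exists_guess_isAccepting ((h A T 𝒯 _).2 hX)
    exact ⟨ρ, hρ⟩

theorem reindex {P : ∀ A : Type, [L.Structure A] → (κ → Set A) → Prop}
    (h : Recognizable L w P) (f : κ → ι) :
    Recognizable L w (fun A _ (V : ι → Set A) => P A fun k => V (f k)) := by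
  obtain ⟨N, hN, h⟩ := h
  exact ⟨N.comap (Letter.reindex f), hN, fun A T _ _ 𝒯 V => h A T 𝒯 fun k => V (f k)⟩

theorem search (D : Letter L w ι → Prop)
    (h : ∀ (A T : Type) [L.Structure A] (𝒯 : NormalizedTreeDecomposition L w A T)
      (V : ι → Set A), (∃ s, D (𝒯.letter V s)) ↔ P A V) : Recognizable L w P :=
  ⟨TreeAutomaton.search D, inferInstanceAs (Finite Prop), fun A T _ _ 𝒯 V => by
    rw [TreeAutomaton.search_accepts_iff, h]⟩

theorem meets (i j : ι) :
    Recognizable L w (fun A _ (V : ι → Set A) => ∃ a, a ∈ V i ∧ a ∈ V j) := by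
  refine search (fun x => ∃ k, k ∈ x.marks i ∧ k ∈ x.marks j) fun A T _ 𝒯 V => ?_
  constructor
  · rintro ⟨s, k, hi, hj⟩
    exact ⟨𝒯.bag s k, hi, hj⟩
  · rintro ⟨a, hi, hj⟩
    obtain ⟨s, k, rfl⟩ := 𝒯.cover a
    exact ⟨s, k, hi, hj⟩

/-- A related tuple lies in one bag, so a single letter witnesses it. -/
theorem rel {r : ℕ} (R : L.Relations r) (x : Fin r → ι) :
    Recognizable L w (fun A _ (V : ι → Set A) => ∃ u : Fin r → A, (∀ j, u j ∈ V (x j)) ∧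
      FirstOrder.Language.Structure.RelMap R u) := by
  refine search (fun a => ∃ f : Fin r → Fin (w + 1), ⟨⟨r, R⟩, f⟩ ∈ a.facts ∧
    ∀ j, f j ∈ a.marks (x j)) fun A T _ 𝒯 V => ?_
  constructor
  · rintro ⟨s, f, h, hf⟩
    exact ⟨fun j => 𝒯.bag s (f j), hf, h⟩
  · rintro ⟨u, hu, h⟩
    obtain ⟨s, hs⟩ := 𝒯.rel_cover R u h
    choose f hf using hs
    obtain rfl : (fun j => 𝒯.bag s (f j)) = u := funext hf
    exact ⟨s, f, h, hu⟩

theorem subset (i j : ι) : Recognizable L w (fun A _ (V : ι → Set A) => V i ⊆ V j) := by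
  -- Inclusion means that no set meets `V i` without meeting `V j`; singletons suffice to test this.
  have := ((meets (L := L) (w := w) none (some i)).and (meets none (some j)).not).existsSet.not
  convert this using 4 with A _ V
  simp only [Option.elim_none, Option.elim_some, not_exists, not_and, not_forall, not_not]
  constructor
  · rintro h X ⟨a, ha, hi⟩
    exact ⟨a, ha, h hi⟩
  · intro h a ha
    obtain ⟨_, rfl, hj⟩ := h {a} ⟨a, rfl, ha⟩
    exact hj

theorem singleton (i : ι) :
    Recognizable L w (fun A _ (V : ι → Set A) => ∃ a, V i = {a}) := by
  -- A singleton is a nonempty set that is contained in every set meeting it.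
  have := (meets (L := L) (w := w) i i).and
    (((meets none (some i)).and (subset (some i) none).not).existsSet.not)
  convert this using 4 with A _ V
  simp only [Option.elim_none, Option.elim_some, not_exists, not_and, not_not, and_self]
  constructor
  · rintro ⟨a, ha⟩
    rw [ha]
    refine ⟨⟨a, rfl⟩, ?_⟩
    rintro X ⟨_, hb, rfl⟩
    simpa using hb
  · rintro ⟨⟨a, ha⟩, h⟩
    exact ⟨a, (h {a} ⟨a, rfl, ha⟩).antisymm (Set.singleton_subset_iff.2 ha)⟩

/-- Quantification over elements as quantification over singletons. -/
theorem existsElem {P : ∀ A : Type, [L.Structure A] → (Option ι → Set A) → Prop}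
    (h : Recognizable L w P) :
    Recognizable L w
      (fun A _ (V : ι → Set A) => ∃ a, P A (fun k : Option ι => k.elim {a} V)) := by
  have := ((singleton (L := L) (w := w) (none : Option ι)).and h).existsSet
  convert this using 4 with A _ V
  simp only [Option.elim_none]
  constructor
  · rintro ⟨a, ha⟩
    exact ⟨{a}, ⟨a, rfl⟩, ha⟩
  · rintro ⟨_, ⟨a, rfl⟩, ha⟩
    exact ⟨a, ha⟩

end Recognizable

/-! ### From formulas to automata -/

/-- Every MSO formula defines a recognizable query, where the individual variables are represented
by singletons. -/
theorem MSOFormula.exists_recognizable (w : ℕ) {n m : ℕ} (φ : MSOFormula L n m) :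
    ∃ P : ∀ A : Type, [L.Structure A] → (Fin n ⊕ Fin m → Set A) → Prop, Recognizable L w P ∧
      ∀ (A : Type) [L.Structure A] (v : Fin n → A) (V : Fin m → Set A),
        P A (Sum.elim (fun k => {v k}) V) ↔ φ.Realize v V := by
  induction φ with
  | rel R x =>
    refine ⟨_, .rel R fun j => .inl (x j), fun A _ v V => ?_⟩
    simp only [Sum.elim_inl, Set.mem_singleton_iff, MSOFormula.Realize]
    constructor
    · rintro ⟨u, hu, h⟩
      rwa [← funext hu]
    · exact fun h => ⟨_, fun _ => rfl, h⟩
  | equal x y =>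
    refine ⟨_, .meets (.inl x) (.inl y), fun A _ v V => ?_⟩
    simp [MSOFormula.Realize]
  | mem x X =>
    refine ⟨_, .meets (.inl x) (.inr X), fun A _ v V => ?_⟩
    simp [MSOFormula.Realize]
  | not φ ih =>
    obtain ⟨P, hP, h⟩ := ih
    exact ⟨_, hP.not, fun A _ v V => not_congr (h A v V)⟩
  | and φ ψ ih₁ ih₂ =>
    obtain ⟨P, hP, h⟩ := ih₁
    obtain ⟨Q, hQ, h'⟩ := ih₂
    exact ⟨_, hP.and hQ, fun A _ v V => and_congr (h A v V) (h' A v V)⟩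
  | @existsElem n m φ ih =>
    obtain ⟨P, hP, h⟩ := ih
    -- The new index `none` stands for the last variable, the one the quantifier binds.
    refine ⟨_, (hP.reindex (Sum.elim (Fin.lastCases none fun k => some (.inl k))
      fun k => some (.inr k))).existsElem, fun A _ v V => ?_⟩
    refine exists_congr fun a => ?_
    rw [← h]
    refine iff_of_eq (congrArg (P A) (funext ?_))
    rintro (k | k)
    · induction k using Fin.lastCases <;> simp
    · simp
  | @existsSet n m φ ih =>
    obtain ⟨P, hP, h⟩ := ih
    refine ⟨_, (hP.reindex (Sum.elim (fun k => some (.inl k))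
      (Fin.lastCases none fun k => some (.inr k)))).existsSet, fun A _ v V => ?_⟩
    refine exists_congr fun X => ?_
    rw [← h]
    refine iff_of_eq (congrArg (P A) (funext ?_))
    rintro (k | k)
    · simp
    · induction k using Fin.lastCases <;> simp

/-- For every unary query there is a finite automaton with a set of distinguished positions at
each state, such that the answers are the elements at distinguished positions in accepting runs. -/
theorem UnaryQuery.exists_treeAutomaton (w : ℕ) (φ : UnaryQuery L) :
    ∃ (N : TreeAutomaton (Letter L w Empty)) (mark : N.State → Set (Fin (w + 1))),
      Finite N.State ∧
      ∀ (A T : Type) [Finite T] [L.Structure A] (𝒯 : NormalizedTreeDecomposition L w A T) (a : A),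
        φ.Holds a ↔ ∃ ρ, N.IsAccepting 𝒯.tree (𝒯.letter Empty.elim) ρ ∧
          ∃ s, ∃ i ∈ mark (ρ s), 𝒯.bag s i = a := by
  obtain ⟨P, hP, h⟩ := MSOFormula.exists_recognizable w φ
  -- The query `P` is controlled only where individual variables are singletons, so this condition
  -- is added explicitly.
  obtain ⟨N, hN, hNP⟩ := ((Recognizable.singleton (L := L) (w := w) (none : Option Empty)).and
    (hP.reindex fun _ => none))
  -- The second component of a state is the guessed marking, so it points at the answer.
  refine ⟨N.guess, Prod.snd, inferInstanceAs (Finite (N.State × Set (Fin (w + 1)))),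
    fun A T _ _ 𝒯 a => ?_⟩
  have ha : ∀ a : A, P A (fun _ => {a}) ↔ φ.Holds a := by
    intro a
    rw [UnaryQuery.Holds, ← h]
    refine iff_of_eq (congrArg (P A) (funext ?_))
    rintro (k | k)
    · rfl
    · exact k.elim0
  constructor
  · intro H
    obtain ⟨ρ, hρ, hX⟩ := TreeAutomaton.exists_guess_isAccepting (𝒯 := 𝒯) (V := Empty.elim)
      (X := {a}) ((hNP A T 𝒯 _).2 ⟨⟨a, rfl⟩, (ha a).2 H⟩)
    obtain ⟨s, i, hi⟩ := 𝒯.cover a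
    exact ⟨ρ, hρ, s, i, (hX s).symm ▸ hi, hi⟩
  · rintro ⟨ρ, hρ, s, i, hi, rfl⟩
    obtain ⟨X, hX, hX'⟩ := TreeAutomaton.exists_of_guess_isAccepting hρ
    obtain ⟨⟨a, rfl⟩, hPa⟩ := (hNP A T 𝒯 _).1 hX'
    rw [hX] at hi
    obtain rfl : 𝒯.bag s i = a := hi
    exact (ha _).1 hPa

/-! ### Rule bodies -/

section Body

variable {L : FirstOrder.Language.{0, 0}} {w : ℕ}

/-- The variable for the `i`-th entry of the bag; the variable `0` stands for the node. -/
def posVar (i : Fin (w + 1)) : ℕ := i + 1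

/-- The variable for the new element at an element replacement node. -/
def newVar (w : ℕ) : ℕ := w + 2

/-- The variables for the children of the node. -/
def childVar (w : ℕ) : Bool → ℕ
  | false => w + 3
  | true => w + 4

/-- The kinds of nodes of a normalized tree decomposition. -/
inductive NodeKind (w : ℕ) : Type
  | leaf
  | perm (π : {π : Equiv.Perm (Fin (w + 1)) // π ≠ 1})
  | replace
  | branch

instance : Finite (NodeKind w) := by
  refine Finite.of_injective (β := Option (Option (Option _))) (fun
    | .leaf => none
    | .replace => some none
    | .branch => some (some none)
    | .perm π => some (some (some π))) ?_
  rintro (_ | _ | _ | _) (_ | _ | _ | _) h <;> simp_all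

/-- The variables for the entries of the bag at a child. -/
def NodeKind.childArgs : NodeKind w → Bool → Option (Fin (w + 1) → ℕ)
  | .leaf, _ => none
  | .perm π, false => some fun i => posVar (π.1 i)
  | .perm _, true => none
  | .replace, false => some fun i => if i = 0 then newVar w else posVar i
  | .replace, true => none
  | .branch, _ => some posVar

/-- The equality pattern between the bags at the node and at a child. -/
def NodeKind.edge (k : NodeKind w) (b : Bool) : Set (Fin (w + 1) × Fin (w + 1)) :=
  {p | ∃ x, k.childArgs b = some x ∧ x p.2 = posVar p.1}

def bagAtom (y : ℕ) (x : Fin (w + 1) → ℕ) : ExtAtom (tdLanguage L w) :=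
  ⟨w + 2, TdRelation.bag, Fin.cons y x⟩

def leafAtom : ExtAtom (tdLanguage L w) := ⟨1, TdRelation.leaf, fun _ => 0⟩

def rootAtom : ExtAtom (tdLanguage L w) := ⟨1, TdRelation.root, fun _ => 0⟩

def childAtom : Bool → ExtAtom (tdLanguage L w)
  | false => ⟨2, TdRelation.child₁, ![childVar w false, 0]⟩
  | true => ⟨2, TdRelation.child₂, ![childVar w true, 0]⟩

def factAtom (x : BagFact L w) : ExtAtom (tdLanguage L w) :=
  ⟨x.1.1, TdRelation.base x.1.2, fun j => posVar (x.2 j)⟩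

theorem bagAtom_vars (y : ℕ) (x : Fin (w + 1) → ℕ) :
    (bagAtom (L := L) y x).vars = insert y (Set.range x) :=
  Fin.range_cons y x

theorem childAtom_vars (b : Bool) : (childAtom (L := L) (w := w) b).vars = {childVar w b, 0} := by
  cases b <;> simp [childAtom, ExtAtom.vars, Set.pair_comm]

/-- The variables of a rule body. -/
def NodeKind.vars (k : NodeKind w) : Set ℕ :=
  {y | y = 0 ∨ y ∈ Set.range (posVar (w := w)) ∨
    ∃ b x, k.childArgs b = some x ∧ (y = childVar w b ∨ y ∈ Set.range x)}

theorem factAtom_vars_subset (k : NodeKind w) (x : BagFact L w) : (factAtom x).vars ⊆ k.vars := by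
  rintro _ ⟨j, rfl⟩
  exact .inr (.inl ⟨_, rfl⟩)

section Holds

variable {A T : Type} [L.Structure A] {𝒯 : NormalizedTreeDecomposition L w A T} {σ : ℕ → A ⊕ T}
  {k : NodeKind w} {S : Set (BagFact L w)}

theorem bagAtom_holds {y : ℕ} {x : Fin (w + 1) → ℕ} :
    (bagAtom y x).Holds 𝒯.tdStructure σ ↔
      ∃ s, σ y = .inr s ∧ ∀ i, σ (x i) = .inl (𝒯.bag s i) :=
  Iff.rfl

theorem leafAtom_holds :
    leafAtom.Holds 𝒯.tdStructure σ ↔ ∃ s, σ 0 = .inr s ∧ 𝒯.tree.first s = none :=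
  Iff.rfl

theorem rootAtom_holds : rootAtom.Holds 𝒯.tdStructure σ ↔ σ 0 = .inr 𝒯.tree.root :=
  Iff.rfl

theorem childAtom_holds {b : Bool} : (childAtom b).Holds 𝒯.tdStructure σ ↔
    ∃ t s, σ (childVar w b) = .inr t ∧ σ 0 = .inr s ∧ 𝒯.tree.child s b = some t := by
  cases b <;> exact Iff.rfl

theorem factAtom_holds {s : T} (hs : ∀ i, σ (posVar i) = .inl (𝒯.bag s i)) {x : BagFact L w} :
    (factAtom x).Holds 𝒯.tdStructure σ ↔ x ∈ 𝒯.bagFacts s := by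
  constructor
  · rintro ⟨u, hu, h⟩
    obtain rfl : (fun j => 𝒯.bag s (x.2 j)) = u :=
      funext fun j => Sum.inl_injective ((hs _).symm.trans (hu j))
    exact h
  · exact fun h => ⟨_, fun j => hs _, h⟩

/-- What the truth of a rule body says about the node. -/
structure Matches (𝒯 : NormalizedTreeDecomposition L w A T) (k : NodeKind w)
    (S : Set (BagFact L w)) (σ : ℕ → A ⊕ T) (s : T) : Prop where
  node : σ 0 = .inr s
  pos : ∀ i, σ (posVar i) = .inl (𝒯.bag s i)
  letter : 𝒯.letter Empty.elim s = ⟨S, k.edge, Empty.elim⟩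
  no_child : ∀ b, k.childArgs b = none → 𝒯.tree.child s b = none
  child : ∀ b x, k.childArgs b = some x → ∃ t, 𝒯.tree.child s b = some t ∧
    σ (childVar w b) = .inr t ∧ ∀ i, σ (x i) = .inl (𝒯.bag t i)

/-- Rule bodies do not assert directly that a second child is absent; they infer it from a changed
bag. -/
theorem NormalizedTreeDecomposition.second_eq_none {s t : T} (hs : 𝒯.tree.first s = some t) (h : 𝒯.bag t ≠ 𝒯.bag s) :
    𝒯.tree.second s = none := by
  cases hs' : 𝒯.tree.second s with
  | none => rfl
  | some t' => exact absurd (𝒯.branch s t t' hs hs').1 h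

/-- This is the source of functional dependence: the node fixes its bag, its children and their
bags. -/
theorem Matches.eq_of_mem_vars {s : T} {σ' : ℕ → A ⊕ T} (h : Matches 𝒯 k S σ s)
    (h' : Matches 𝒯 k S σ' s) {y : ℕ} (hy : y ∈ k.vars) : σ y = σ' y := by
  rcases hy with rfl | ⟨i, rfl⟩ | ⟨b, x, hb, hy⟩
  · rw [h.node, h'.node]
  · rw [h.pos, h'.pos]
  · obtain ⟨t, ht, ht', hx⟩ := h.child b x hb
    obtain ⟨t₁, ht₁, ht₁', hx₁⟩ := h'.child b x hb
    obtain rfl := Option.some.inj (ht.symm.trans ht₁)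
    rcases hy with rfl | ⟨j, rfl⟩
    · rw [ht', ht₁']
    · rw [hx, hx₁]

theorem exists_substitution (𝒯 : NormalizedTreeDecomposition L w A T) (s t₁ t₂ : T) (a : A) :
    ∃ σ : ℕ → A ⊕ T, σ 0 = .inr s ∧ (∀ i, σ (posVar i) = .inl (𝒯.bag s i)) ∧
      σ (newVar w) = .inl a ∧ σ (childVar w false) = .inr t₁ ∧ σ (childVar w true) = .inr t₂ := by
  -- Variables 1 to w + 1 are the bag positions, shifted by one to leave 0 for the node.
  refine ⟨fun y => if y = 0 then .inr s else if h : y - 1 < w + 1 then .inl (𝒯.bag s ⟨y - 1, h⟩)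
    else if y = w + 2 then .inl a else if y = w + 3 then .inr t₁ else .inr t₂, ?_⟩
  refine ⟨rfl, fun i => ?_, by simp [newVar], by simp [childVar], by simp [childVar]⟩
  simp [posVar, i.2]

end Holds

variable [Finite (Σ r, L.Relations r)]

open Classical in
/-- The positive extensional part of the body of a rule for a node of kind `k` with the relations
`S` in its bag. -/
noncomputable def bodyPos (k : NodeKind w) (S : Set (BagFact L w)) :
    List (ExtAtom (tdLanguage L w)) :=
  bagAtom 0 posVar :: ((if k = .leaf then [leafAtom] else []) ++
    ([false, true].flatMap fun b => ((k.childArgs b).map fun x =>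
      [childAtom b, bagAtom (childVar w b) x]).getD []) ++
    S.toFinite.toFinset.toList.map factAtom)

open Classical in
/-- The negated extensional part. -/
noncomputable def bodyNeg (k : NodeKind w) (S : Set (BagFact L w)) :
    List (ExtAtom (tdLanguage L w)) :=
  (if k = .replace then [bagAtom (childVar w false) posVar] else []) ++
    Sᶜ.toFinite.toFinset.toList.map factAtom

theorem mem_bodyPos {k : NodeKind w} {S : Set (BagFact L w)} {B : ExtAtom (tdLanguage L w)} :
    B ∈ bodyPos k S ↔ B = bagAtom 0 posVar ∨ (k = .leaf ∧ B = leafAtom) ∨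
      (∃ b x, k.childArgs b = some x ∧ (B = childAtom b ∨ B = bagAtom (childVar w b) x)) ∨
      ∃ x ∈ S, factAtom x = B := by
  have : ∀ b, B ∈ (((k.childArgs b).map fun x =>
      [childAtom b, bagAtom (childVar w b) x]).getD []) ↔
      ∃ x, k.childArgs b = some x ∧ (B = childAtom b ∨ B = bagAtom (childVar w b) x) := by
    intro b
    cases k.childArgs b <;> simp
  simp only [bodyPos, List.mem_cons, List.mem_append, List.mem_flatMap, this, List.mem_map,
    Finset.mem_toList, Set.Finite.mem_toFinset, or_assoc]
  by_cases hk : k = .leaf <;> simp [hk]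

theorem mem_bodyNeg {k : NodeKind w} {S : Set (BagFact L w)} {B : ExtAtom (tdLanguage L w)} :
    B ∈ bodyNeg k S ↔ (k = .replace ∧ B = bagAtom (childVar w false) posVar) ∨
      ∃ x ∉ S, factAtom x = B := by
  by_cases hk : k = .replace <;> simp [bodyNeg, hk]

theorem exists_mem_bodyPos {k : NodeKind w} (S : Set (BagFact L w)) {y : ℕ} (hy : y ∈ k.vars) :
    ∃ B ∈ bodyPos k S, y ∈ B.vars := by
  rcases hy with hy | hy | ⟨b, x, hx, hy⟩
  · exact ⟨_, mem_bodyPos.2 (.inl rfl), by simp [bagAtom_vars, hy]⟩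
  · exact ⟨_, mem_bodyPos.2 (.inl rfl), by simpa [bagAtom_vars] using .inr hy⟩
  · exact ⟨_, mem_bodyPos.2 (.inr (.inr (.inl ⟨b, x, hx, .inr rfl⟩))), by
      simpa [bagAtom_vars] using hy⟩

theorem vars_subset_of_mem_bodyPos {k : NodeKind w} {S : Set (BagFact L w)}
    {B : ExtAtom (tdLanguage L w)} (hB : B ∈ bodyPos k S) : B.vars ⊆ k.vars := by
  rcases mem_bodyPos.1 hB with rfl | ⟨-, rfl⟩ | ⟨b, x, hx, rfl | rfl⟩ | ⟨x, -, rfl⟩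
  · rw [bagAtom_vars]
    rintro y (hy | hy)
    exacts [.inl hy, .inr (.inl hy)]
  · rintro _ ⟨_, rfl⟩
    exact .inl rfl
  · rw [childAtom_vars]
    rintro y (hy | hy)
    exacts [.inr (.inr ⟨b, x, hx, .inl hy⟩), .inl hy]
  · rw [bagAtom_vars]
    rintro y (hy | hy)
    exacts [.inr (.inr ⟨b, x, hx, .inl hy⟩), .inr (.inr ⟨b, x, hx, .inr hy⟩)]
  · exact factAtom_vars_subset k x

theorem vars_subset_of_mem_bodyNeg {k : NodeKind w} {S : Set (BagFact L w)}
    {B : ExtAtom (tdLanguage L w)} (hB : B ∈ bodyNeg k S) : B.vars ⊆ k.vars := by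
  rcases mem_bodyNeg.1 hB with ⟨rfl, rfl⟩ | ⟨x, -, rfl⟩
  · rw [bagAtom_vars]
    rintro y (hy | hy)
    exacts [.inr (.inr ⟨false, _, rfl, .inl hy⟩), .inr (.inl hy)]
  · exact factAtom_vars_subset k x

/-! ### Rule bodies determine the kind and letter of a node -/

section Semantics

variable {A T : Type} [L.Structure A]

/-- The body of the rules for nodes of kind `k` with relations `S` is true. -/
def BodyHolds (𝒯 : NormalizedTreeDecomposition L w A T) (k : NodeKind w) (S : Set (BagFact L w))
    (σ : ℕ → A ⊕ T) : Prop :=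
  (∀ B ∈ bodyPos k S, B.Holds 𝒯.tdStructure σ) ∧ ∀ B ∈ bodyNeg k S, ¬ B.Holds 𝒯.tdStructure σ

variable {𝒯 : NormalizedTreeDecomposition L w A T} {k : NodeKind w} {S : Set (BagFact L w)}
  {σ : ℕ → A ⊕ T}

theorem bodyHolds_iff : BodyHolds 𝒯 k S σ ↔
    ∃ s, σ 0 = .inr s ∧ (∀ i, σ (posVar i) = .inl (𝒯.bag s i)) ∧ 𝒯.bagFacts s = S ∧
      (k = .leaf → 𝒯.tree.first s = none) ∧
      (∀ b x, k.childArgs b = some x → ∃ t, 𝒯.tree.child s b = some t ∧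
        σ (childVar w b) = .inr t ∧ ∀ i, σ (x i) = .inl (𝒯.bag t i)) ∧
      (k = .replace → ∀ t, 𝒯.tree.child s false = some t → 𝒯.bag t ≠ 𝒯.bag s) := by
  constructor
  · rintro ⟨hp, hn⟩
    obtain ⟨s, hs, hx⟩ := bagAtom_holds.1 (hp _ (mem_bodyPos.2 (.inl rfl)))
    have hc : ∀ b x, k.childArgs b = some x → ∃ t, 𝒯.tree.child s b = some t ∧
        σ (childVar w b) = .inr t ∧ ∀ i, σ (x i) = .inl (𝒯.bag t i) := by
      intro b x hb
      obtain ⟨t, s', ht, hs', hst⟩ := childAtom_holds.1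
        (hp _ (mem_bodyPos.2 (.inr (.inr (.inl ⟨b, x, hb, .inl rfl⟩)))))
      obtain ⟨t', ht', hx'⟩ := bagAtom_holds.1
        (hp _ (mem_bodyPos.2 (.inr (.inr (.inl ⟨b, x, hb, .inr rfl⟩)))))
      obtain rfl := Sum.inr_injective (hs.symm.trans hs')
      obtain rfl := Sum.inr_injective (ht.symm.trans ht')
      exact ⟨t, hst, ht, hx'⟩
    refine ⟨s, hs, hx, ?_, ?_, hc, ?_⟩
    · ext x
      rw [← factAtom_holds hx]
      refine ⟨fun h => by_contra fun hxS => ?_, fun h => ?_⟩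
      · exact hn _ (mem_bodyNeg.2 (.inr ⟨x, hxS, rfl⟩)) h
      · exact hp _ (mem_bodyPos.2 (.inr (.inr (.inr ⟨x, h, rfl⟩))))
    · intro hk
      obtain ⟨s', hs', h⟩ := leafAtom_holds.1 (hp _ (mem_bodyPos.2 (.inr (.inl ⟨hk, rfl⟩))))
      obtain rfl := Sum.inr_injective (hs.symm.trans hs')
      exact h
    · rintro rfl t ht hst
      obtain ⟨t', ht', h', -⟩ := hc false _ rfl
      obtain rfl := Option.some.inj (ht.symm.trans ht')
      exact hn _ (mem_bodyNeg.2 (.inl ⟨rfl, rfl⟩)) (bagAtom_holds.2 ⟨t, h', hst ▸ hx⟩)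
  · rintro ⟨s, hs, hx, rfl, hl, hc, hr⟩
    refine ⟨fun B hB => ?_, fun B hB => ?_⟩
    · rcases mem_bodyPos.1 hB with rfl | ⟨hk, rfl⟩ | ⟨b, x, hb, rfl | rfl⟩ | ⟨x, hxS, rfl⟩
      · exact bagAtom_holds.2 ⟨s, hs, hx⟩
      · exact leafAtom_holds.2 ⟨s, hs, hl hk⟩
      · obtain ⟨t, ht, ht', -⟩ := hc b x hb
        exact childAtom_holds.2 ⟨t, s, ht', hs, ht⟩
      · obtain ⟨t, -, ht', h⟩ := hc b x hb
        exact bagAtom_holds.2 ⟨t, ht', h⟩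
      · exact (factAtom_holds hx).2 hxS
    · rcases mem_bodyNeg.1 hB with ⟨rfl, rfl⟩ | ⟨x, hxS, rfl⟩
      · rw [bagAtom_holds]
        rintro ⟨t, ht, h⟩
        obtain ⟨t', ht', h', -⟩ := hc false _ rfl
        obtain rfl := Sum.inr_injective (ht.symm.trans h')
        exact hr rfl t ht' (funext fun i => Sum.inl_injective ((h i).symm.trans (hx i)))
      · rwa [factAtom_holds hx]

/-- A nontrivial permutation, or the negated bag atom for replacement, shows that the child's bag
differs, which excludes branch nodes. As bags have distinct entries, the shared variables of the bag
atoms then give the exact equality pattern. -/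
theorem BodyHolds.exists_matches (h : BodyHolds 𝒯 k S σ) : ∃ s, Matches 𝒯 k S σ s := by
  obtain ⟨s, hs, hx, rfl, hl, hc, hr⟩ := bodyHolds_iff.1 h
  have hn : ∀ b, k.childArgs b = none → 𝒯.tree.child s b = none := by
    intro b hb
    match k, b, hb with
    | .leaf, false, _ => exact hl rfl
    | .leaf, true, _ => exact 𝒯.tree.second_eq_none s (hl rfl)
    | .perm π, true, _ =>
      obtain ⟨t, ht, -, h⟩ := hc false _ rfl
      refine NormalizedTreeDecomposition.second_eq_none ht fun hst => π.2 (Equiv.ext fun i => 𝒯.bag_injective s ?_)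
      exact Sum.inl_injective ((hx _).symm.trans ((h i).trans (by rw [hst]; rfl)))
    | .replace, true, _ =>
      obtain ⟨t, ht, -, h⟩ := hc false _ rfl
      exact NormalizedTreeDecomposition.second_eq_none ht (hr rfl t ht)
  refine ⟨s, hs, hx, ?_, hn, hc⟩
  ext1
  · rfl
  · funext b
    ext ⟨i, j⟩
    cases hb : k.childArgs b with
    | none =>
      simp [NormalizedTreeDecomposition.letter, NormalizedTreeDecomposition.bagEdge,
        NodeKind.edge, hb, hn b hb]
    | some x =>
      obtain ⟨t, ht, -, h⟩ := hc b x hb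
      suffices H : 𝒯.bag s i = 𝒯.bag t j ↔ x j = posVar i by
        simpa [NormalizedTreeDecomposition.letter, NormalizedTreeDecomposition.bagEdge,
          NodeKind.edge, hb, ht] using H
      refine ⟨fun hij => ?_, fun hij => ?_⟩
      -- If position `j` of the child carries the variable of some parent position, that position is
      -- `i` by injectivity of the bag.
      · have key : ∀ i' : Fin (w + 1), x j = posVar i' → x j = posVar i := by
          intro i' hi'
          have : 𝒯.bag s i' = 𝒯.bag s i := by
            rw [hij]
            exact Sum.inl_injective ((hx i').symm.trans (hi' ▸ h j))
          rwa [← 𝒯.bag_injective s this]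
        match k, b, hb with
        | .perm π, false, hb => exact key (π.1 j) (by cases hb; rfl)
        | .branch, _, hb => exact key j (by cases hb; rfl)
        | .replace, false, hb =>
          obtain rfl := Option.some.inj hb
          by_cases hj : j = 0
          -- The new element differs from every entry of the old bag: equal to entry 0 it would
          -- leave the bag unchanged, equal to another entry it would occur twice in the child's
          -- bag.
          · exfalso
            subst hj
            have hi : ∀ i ≠ 0, 𝒯.bag t i = 𝒯.bag s i := fun i hi => by
              have := h i
              simp only [if_neg hi, hx] at this
              exact (Sum.inl_injective this).symm
            by_cases hi0 : i = 0
            · subst hi0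
              refine hr rfl t ht (funext fun i => ?_)
              by_cases h0 : i = 0
              · rw [h0, hij]
              · exact hi i h0
            · exact hi0 (𝒯.bag_injective t ((hi i hi0).trans hij))
          · exact key j (if_neg hj)
      · exact Sum.inl_injective ((hx i).symm.trans (hij ▸ h j))
  · exact Subsingleton.elim _ _

/-- At every node some rule body is true. -/
theorem exists_bodyHolds (𝒯 : NormalizedTreeDecomposition L w A T) (s : T) :
    ∃ k σ, σ 0 = .inr s ∧ BodyHolds 𝒯 k (𝒯.bagFacts s) σ := by
  cases h₁ : 𝒯.tree.first s with
  | none =>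
    obtain ⟨σ, h0, hp, -⟩ := exists_substitution 𝒯 s s s (𝒯.bag s 0)
    exact ⟨.leaf, σ, h0, bodyHolds_iff.2 ⟨s, h0, hp, rfl, fun _ => h₁,
      by rintro _ _ ⟨⟩, by rintro ⟨⟩⟩⟩
  | some t =>
    cases h₂ : 𝒯.tree.second s with
    | none =>
      obtain ⟨σ, h0, hp, hn, hc, -⟩ := exists_substitution 𝒯 s t t (𝒯.bag t 0)
      rcases 𝒯.unary s t h₁ h₂ with ⟨π, hπ, h⟩ | ⟨hne, h⟩
      · refine ⟨.perm ⟨π, hπ⟩, σ, h0, bodyHolds_iff.2 ⟨s, h0, hp, rfl, by rintro ⟨⟩, ?_,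
          by rintro ⟨⟩⟩⟩
        rintro (_ | _) x ⟨⟩
        exact ⟨t, h₁, hc, fun i => by rw [h, hp]⟩
      · refine ⟨.replace, σ, h0, bodyHolds_iff.2 ⟨s, h0, hp, rfl, by rintro ⟨⟩, ?_, ?_⟩⟩
        · rintro (_ | _) x ⟨⟩
          refine ⟨t, h₁, hc, fun i => ?_⟩
          by_cases hi : i = 0
          · simp [hi, hn]
          · simp only [if_neg hi, hp, h i hi]
        · intro _ t' ht' h'
          obtain rfl := Option.some.inj (h₁.symm.trans ht')
          exact hne (congrFun h' 0)
    | some t' =>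
      obtain ⟨σ, h0, hp, -, hc, hc'⟩ := exists_substitution 𝒯 s t t' (𝒯.bag t 0)
      obtain ⟨hb, hb'⟩ := 𝒯.branch s t t' h₁ h₂
      refine ⟨.branch, σ, h0, bodyHolds_iff.2 ⟨s, h0, hp, rfl, by rintro ⟨⟩, ?_,
        by rintro ⟨⟩⟩⟩
      rintro (_ | _) x ⟨⟩
      · exact ⟨t, h₁, hc, fun i => by rw [hb, hp]⟩
      · exact ⟨t', h₂, hc', fun i => by rw [hb', hp]⟩

end Semantics

end Body

/-! ### The program -/

section Program

variable {L : FirstOrder.Language.{0, 0}} {w : ℕ} {Q : Type}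

/-- The intensional predicates: for each state of the automaton one for the runs on subtrees and
one for the accepting runs, and the predicate for the answers. -/
inductive Predicate (Q : Type) : Type
  | up (q : Q)
  | down (q : Q)
  | answer

instance [Finite Q] : Finite (Predicate Q) := by
  refine Finite.of_injective (β := Option (Q ⊕ Q)) (fun
    | .up q => some (.inl q)
    | .down q => some (.inr q)
    | .answer => none) ?_
  rintro (_ | _ | _) (_ | _ | _) h <;> simp_all

/-- The atoms for the states at the children. -/
def childStates (w : ℕ) (name : Predicate Q → ℕ) (o : Bool → Option Q) : List (ℕ × ℕ) :=
  [false, true].flatMap fun b => ((o b).map fun q => (name (.up q), childVar w b)).toList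

theorem mem_childStates {name : Predicate Q → ℕ} {o : Bool → Option Q} {x : ℕ × ℕ} :
    x ∈ childStates w name o ↔ ∃ b q, o b = some q ∧ x = (name (.up q), childVar w b) := by
  simp [childStates, eq_comm]

variable (N : TreeAutomaton (Letter L w Empty)) (mark : N.State → Set (Fin (w + 1)))
  (name : Predicate N.State → ℕ)

/-- The states `q` and `o` at a node and its children are compatible. -/
def Compatible (k : NodeKind w) (S : Set (BagFact L w)) (q : N.State)
    (o : Bool → Option N.State) : Prop :=
  N.step ⟨S, k.edge, Empty.elim⟩ q o ∧ ∀ b, o b = none ↔ k.childArgs b = none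

variable {N mark name}

theorem childVar_mem_vars {k : NodeKind w} {S : Set (BagFact L w)} {q : N.State}
    {o : Bool → Option N.State} (h : Compatible N k S q o) {b : Bool} {q' : N.State}
    (hb : o b = some q') : childVar w b ∈ k.vars := by
  cases hx : k.childArgs b with
  | none => simp [(h.2 b).2 hx] at hb
  | some x => exact .inr (.inr ⟨b, x, hx, .inl rfl⟩)

theorem childStates_vars {k : NodeKind w} {S : Set (BagFact L w)} {q : N.State}
    {o : Bool → Option N.State} (h : Compatible N k S q o) :
    ∀ x ∈ childStates w name o, x.2 ∈ k.vars := by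
  intro x hx
  obtain ⟨b, q', hb, rfl⟩ := mem_childStates.1 hx
  exact childVar_mem_vars h hb

/-! ### Intended interpretation of the intensional predicates -/

section Meaning

variable {A T : Type} [L.Structure A] (𝒯 : NormalizedTreeDecomposition L w A T)

variable (N mark) in
/-- The intended interpretation of the intensional predicates. -/
def Meaning : Predicate N.State → A ⊕ T → Prop
  | .up q, d => ∃ s, d = .inr s ∧ q ∈ N.attainable 𝒯.tree (𝒯.letter Empty.elim) s
  | .down q, d => ∃ s, d = .inr s ∧
      ∃ ρ, N.IsAccepting 𝒯.tree (𝒯.letter Empty.elim) ρ ∧ ρ s = q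
  | .answer, d => ∃ ρ, N.IsAccepting 𝒯.tree (𝒯.letter Empty.elim) ρ ∧
      ∃ s, ∃ i ∈ mark (ρ s), d = .inl (𝒯.bag s i)

variable {𝒯}

/-- Turns the `up` atoms of a body into the data that `mem_attainable_iff` and `exists_glue` need;
compatibility makes `o` defined exactly at the existing children. -/
theorem Meaning.of_children {k : NodeKind w} {S : Set (BagFact L w)} {q : N.State}
    {o : Bool → Option N.State} {σ : ℕ → A ⊕ T} {s : T} (h : Compatible N k S q o)
    (hs : Matches 𝒯 k S σ s)
    (ho : ∀ b q', o b = some q' → Meaning N mark 𝒯 (.up q') (σ (childVar w b))) :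
    N.step (𝒯.letter Empty.elim s) q o ∧ ∀ b,
      (𝒯.tree.child s b = none → o b = none) ∧
      ∀ c, 𝒯.tree.child s b = some c →
        σ (childVar w b) = .inr c ∧
        ∃ q' ∈ N.attainable 𝒯.tree (𝒯.letter Empty.elim) c, o b = some q' := by
  refine ⟨hs.letter.symm ▸ h.1, fun b => ?_⟩
  cases hx : k.childArgs b with
  | none => simp [(h.2 b).2 hx, hs.no_child b hx]
  | some x =>
    obtain ⟨t, ht, hσ, -⟩ := hs.child b x hx
    refine ⟨fun h' => by simp [ht] at h', fun c hc => ?_⟩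
    obtain rfl := Option.some.inj (ht.symm.trans hc)
    obtain ⟨q', hq'⟩ := Option.ne_none_iff_exists'.1 fun h' => by
      simp [(h.2 b).1 h'] at hx
    obtain ⟨t', ht', hq⟩ := ho b q' hq'
    obtain rfl := Sum.inr_injective (hσ.symm.trans ht')
    exact ⟨hσ, q', hq, hq'⟩

theorem Matches.childVar_eq {k : NodeKind w} {S : Set (BagFact L w)} {s t : T} {σ : ℕ → A ⊕ T}
    {b : Bool} (hs : Matches 𝒯 k S σ s) (ht : 𝒯.tree.child s b = some t) :
    σ (childVar w b) = .inr t := by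
  cases hx : k.childArgs b with
  | none => simp [hs.no_child b hx] at ht
  | some x =>
    obtain ⟨t', ht', hσ, -⟩ := hs.child b x hx
    rwa [Option.some.inj (ht.symm.trans ht')]

theorem childStates_mem {k : NodeKind w} {S : Set (BagFact L w)} {s : T} {σ : ℕ → A ⊕ T}
    {ρ : T → N.State} {I : Set (ℕ × (A ⊕ T))} (hs : Matches 𝒯 k S σ s)
    (hI : ∀ b t, 𝒯.tree.child s b = some t → (name (.up (ρ t)), .inr t) ∈ I) :
    ∀ x ∈ childStates w name (fun b => (𝒯.tree.child s b).map ρ), (x.1, σ x.2) ∈ I := by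
  intro x hx
  obtain ⟨b, q, hq, rfl⟩ := mem_childStates.1 hx
  obtain ⟨t, ht, rfl⟩ := Option.map_eq_some_iff.1 hq
  rw [hs.childVar_eq ht]
  exact hI b t ht

end Meaning

variable [Finite (Σ r, L.Relations r)]

/-- A rule for nodes of kind `k` with relations `S`. -/
noncomputable def nodeRule (k : NodeKind w) (S : Set (BagFact L w)) (head : ℕ × ℕ)
    (body : List (ℕ × ℕ)) : MonadicRule (tdLanguage L w) :=
  ⟨head, bodyPos k S, bodyNeg k S, body⟩

def rootRule (name : Predicate Q → ℕ) (q : Q) : MonadicRule (tdLanguage L w) :=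
  ⟨(name (.down q), 0), [bagAtom 0 posVar, rootAtom], [], [(name (.up q), 0)]⟩

def answerRule (name : Predicate Q → ℕ) (q : Q) (i : Fin (w + 1)) : MonadicRule (tdLanguage L w) :=
  ⟨(name .answer, posVar i), [bagAtom 0 posVar], [], [(name (.down q), 0)]⟩

variable (N mark name)

/-- The rules of the program. -/
inductive IsRule : MonadicRule (tdLanguage L w) → Prop
  | up {k S q o} (h : Compatible N k S q o) :
    IsRule (nodeRule k S (name (.up q), 0) (childStates w name o))
  | down {k S q o} (h : Compatible N k S q o) {b q'} (hb : o b = some q') :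
    IsRule (nodeRule k S (name (.down q'), childVar w b)
      ((name (.down q), 0) :: childStates w name o))
  | root {q} (h : N.final q) : IsRule (rootRule name q)
  | answer {q i} (h : i ∈ mark q) : IsRule (answerRule name q i)

/-- A rule is determined by a node kind, a set of bag facts, states and positions, all ranging over
finite types. -/
theorem finite_isRule [Finite N.State] : {r | IsRule N mark name r}.Finite := by
  refine (((Set.finite_range fun x : NodeKind w × Set (BagFact L w) × N.State ×
      (Bool → Option N.State) =>
        nodeRule x.1 x.2.1 (name (.up x.2.2.1), 0) (childStates w name x.2.2.2)).union
    (Set.finite_range fun x : NodeKind w × Set (BagFact L w) × N.State ×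
      (Bool → Option N.State) × Bool × N.State =>
        nodeRule x.1 x.2.1 (name (.down x.2.2.2.2.2), childVar w x.2.2.2.2.1)
          ((name (.down x.2.2.1), 0) :: childStates w name x.2.2.2.1))).union
    ((Set.finite_range fun q : N.State => rootRule name q).union
      (Set.finite_range fun x : N.State × Fin (w + 1) => answerRule name x.1 x.2))).subset ?_
  rintro _ (@⟨k, S, q, o, h⟩ | @⟨k, S, q, o, h, b, q', hb⟩ | @⟨q, h⟩ | @⟨q, i, h⟩)
  · exact .inl (.inl ⟨(k, S, q, o), rfl⟩)
  · exact .inl (.inr ⟨(k, S, q, o, b, q'), rfl⟩)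
  · exact .inr (.inl ⟨q, rfl⟩)
  · exact .inr (.inr ⟨(q, i), rfl⟩)

variable {N mark name}

theorem nodeRule_vars_subset {k : NodeKind w} (S : Set (BagFact L w)) {head : ℕ × ℕ}
    {body : List (ℕ × ℕ)} (hh : head.2 ∈ k.vars) (hb : ∀ x ∈ body, x.2 ∈ k.vars) :
    (nodeRule k S head body).vars ⊆ k.vars := by
  rintro y (rfl | ⟨B, hB, hy⟩ | ⟨B, hB, hy⟩ | ⟨x, hx, rfl⟩)
  · exact hh
  · exact vars_subset_of_mem_bodyPos hB hy
  · exact vars_subset_of_mem_bodyNeg hB hy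
  · exact hb x hx

/-- The variables of each rule are those of its body pattern, or occur in the bag atom. -/
theorem IsRule.cases_vars {r : MonadicRule (tdLanguage L w)} (hr : IsRule N mark name r) :
    (∃ k S head body, r = nodeRule k S head body ∧ r.vars ⊆ k.vars) ∨
      bagAtom 0 posVar ∈ r.posExt ∧ r.vars ⊆ (bagAtom (L := L) (w := w) 0 posVar).vars := by
  rcases hr with ⟨h⟩ | ⟨h, hb⟩ | ⟨h⟩ | ⟨h⟩
  · exact .inl ⟨_, _, _, _, rfl, nodeRule_vars_subset _ (.inl rfl) (childStates_vars h)⟩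
  · refine .inl ⟨_, _, _, _, rfl, nodeRule_vars_subset _ (childVar_mem_vars h hb) fun x hx => ?_⟩
    rcases List.mem_cons.1 hx with rfl | hx
    · exact .inl rfl
    · exact childStates_vars h x hx
  · refine .inr ⟨by simp [rootRule], ?_⟩
    rw [bagAtom_vars]
    intro y
    simp only [MonadicRule.vars, rootRule, Set.mem_ofPred_eq, List.mem_cons, List.not_mem_nil,
      or_false, exists_eq_or_imp, exists_eq_left, bagAtom_vars, false_and, exists_false, false_or]
    rintro (rfl | (h | ⟨_, rfl⟩) | rfl)
    exacts [.inl rfl, h, .inl rfl, .inl rfl]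
  · refine .inr ⟨by simp [answerRule], ?_⟩
    rw [bagAtom_vars]
    intro y
    simp only [MonadicRule.vars, answerRule, Set.mem_ofPred_eq, List.mem_cons, List.not_mem_nil,
      or_false, exists_eq_left, bagAtom_vars, false_and, exists_false, false_or]
    rintro (rfl | h | rfl)
    exacts [.inr ⟨_, rfl⟩, h, .inl rfl]

theorem IsRule.isSafe {r : MonadicRule (tdLanguage L w)} (hr : IsRule N mark name r) :
    r.IsSafe := by
  intro y hy
  rcases hr.cases_vars with ⟨k, S, head, body, rfl, hk⟩ | ⟨hB, hk⟩
  · exact .inl (exists_mem_bodyPos S (hk hy))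
  · exact .inl ⟨_, hB, hk hy⟩

/-- The bag atom of the node guards every rule: in root and answer rules it contains all variables,
in node rules the value of variable 0 already determines the rest. -/
theorem IsRule.exists_guard {r : MonadicRule (tdLanguage L w)} (hr : IsRule N mark name r) :
    ∃ B ∈ r.posExt, ∀ y ∈ r.vars, y ∈ B.vars ∨ FunctionallyDependent r B y := by
  rcases hr.cases_vars with ⟨k, S, head, body, rfl, hk⟩ | ⟨hB, hk⟩
  · refine ⟨bagAtom 0 posVar, mem_bodyPos.2 (.inl rfl), fun y hy => .inr ?_⟩
    intro A T _ _ _ 𝒯 σ σ' h h' hσ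
    obtain ⟨s, hs⟩ := BodyHolds.exists_matches h
    obtain ⟨s', hs'⟩ := BodyHolds.exists_matches h'
    have := hσ 0 (by simp [bagAtom_vars])
    rw [hs.node, hs'.node] at this
    obtain rfl := Sum.inr_injective this
    exact hs.eq_of_mem_vars hs' (hk hy)
  · exact ⟨_, hB, fun y hy => .inl (hk hy)⟩

/-! ### Correctness -/

theorem mem_leastFixpoint {E : FirstOrder.Language.{0, 0}} {D : Type} {P : MonadicProgram E}
    {S : E.Structure D} {r : MonadicRule E} (hr : r ∈ P) {σ : ℕ → D} (hE : r.ExtBodyHolds S σ)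
    (hI : ∀ q ∈ r.intensional, (q.1, σ q.2) ∈ leastFixpoint P S) :
    (r.head.1, σ r.head.2) ∈ leastFixpoint P S := by
  unfold leastFixpoint
  rw [← OrderHom.map_lfp]
  exact ⟨r, hr, σ, hE, hI, rfl⟩

theorem leastFixpoint_subset {E : FirstOrder.Language.{0, 0}} {D : Type} {P : MonadicProgram E}
    {S : E.Structure D} {I : Set (ℕ × D)}
    (h : ∀ r ∈ P, ∀ σ : ℕ → D, r.ExtBodyHolds S σ → (∀ q ∈ r.intensional, (q.1, σ q.2) ∈ I) →
      (r.head.1, σ r.head.2) ∈ I) : leastFixpoint P S ⊆ I := by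
  refine OrderHom.lfp_le _ ?_
  rintro _ ⟨r, hr, σ, hE, hI, rfl⟩
  exact h r hr σ hE hI

variable {A T : Type} [L.Structure A] {𝒯 : NormalizedTreeDecomposition L w A T}

/-- Closure of the intended interpretation under the rules makes it an upper bound for the least
fixpoint. -/
theorem IsRule.sound {r : MonadicRule (tdLanguage L w)} (hr : IsRule N mark name r)
    (hname : Function.Injective name) {σ : ℕ → A ⊕ T} (hE : r.ExtBodyHolds 𝒯.tdStructure σ)
    (hI : ∀ x ∈ r.intensional, ∃ p, name p = x.1 ∧ Meaning N mark 𝒯 p (σ x.2)) :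
    ∃ p, name p = r.head.1 ∧ Meaning N mark 𝒯 p (σ r.head.2) := by
  have hI : ∀ p y, (name p, y) ∈ r.intensional → Meaning N mark 𝒯 p (σ y) := by
    intro p y h
    obtain ⟨p', hp', h'⟩ := hI _ h
    exact hname hp' ▸ h'
  rcases hr with @⟨k, S, q, o, h⟩ | @⟨k, S, q, o, h, b, q', hb⟩ | @⟨q, h⟩ | @⟨q, i, h⟩
  · obtain ⟨s, hs⟩ := BodyHolds.exists_matches hE
    obtain ⟨h₁, h₂⟩ := Meaning.of_children h hs fun b q' hb =>
      hI _ _ (mem_childStates.2 ⟨b, q', hb, rfl⟩)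
    exact ⟨_, rfl, s, hs.node, (N.mem_attainable_iff ..).2
      ⟨o, h₁, fun b => ⟨(h₂ b).1, fun c hc => ((h₂ b).2 c hc).2⟩⟩⟩
  · obtain ⟨s, hs⟩ := BodyHolds.exists_matches hE
    obtain ⟨h₁, h₂⟩ := Meaning.of_children h hs fun b q' hb =>
      hI _ _ (List.mem_cons_of_mem _ (mem_childStates.2 ⟨b, q', hb, rfl⟩))
    obtain ⟨s', hs', ρ, ⟨hρ, hf⟩, rfl⟩ := hI (.down q) 0 List.mem_cons_self
    obtain rfl := Sum.inr_injective (hs.node.symm.trans hs')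
    -- The accepting run through `q` at `s` may have other states at the children; grafting the runs
    -- given by the `up` atoms yields the states `o` there and keeps the root state, hence
    -- acceptance.
    obtain ⟨ρ', -, hroot, ho, -, hrun⟩ := TreeAutomaton.exists_glue h₁ (fun b => (h₂ b).1)
      fun b c hc => ((h₂ b).2 c hc).2
    obtain ⟨t, ht, hq'⟩ := Option.map_eq_some_iff.1 ((ho b).trans hb)
    exact ⟨_, rfl, t, ((h₂ b).2 t ht).1, ρ', ⟨fun u => hrun u (hρ u), hroot ▸ hf⟩, hq'⟩
  · have h₀ := rootAtom_holds.1 (hE.1 rootAtom (by simp [rootRule]))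
    obtain ⟨s, hs, ρ, rfl, hρ⟩ := hI (.up q) 0 List.mem_cons_self
    obtain rfl := Sum.inr_injective (h₀.symm.trans hs)
    exact ⟨_, rfl, _, h₀, ρ, ⟨fun s => hρ s (RootedBinaryTree.root_below s), h⟩, rfl⟩
  · obtain ⟨s', hs', hx⟩ := bagAtom_holds.1 (hE.1 (bagAtom 0 posVar) (by simp [answerRule]))
    obtain ⟨s, hs, ρ, hρ, rfl⟩ := hI (.down q) 0 List.mem_cons_self
    obtain rfl := Sum.inr_injective (hs.symm.trans hs')
    exact ⟨_, rfl, ρ, hρ, s, i, h, hx i⟩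

/-- For completeness: each node of a run supplies a true rule body whose states are those of the
run. -/
theorem exists_compatible {ρ : T → N.State} {s : T}
    (hρ : N.RunAt 𝒯.tree (𝒯.letter Empty.elim) ρ s) :
    ∃ k σ, BodyHolds 𝒯 k (𝒯.bagFacts s) σ ∧ Matches 𝒯 k (𝒯.bagFacts s) σ s ∧
      Compatible N k (𝒯.bagFacts s) (ρ s) fun b => (𝒯.tree.child s b).map ρ := by
  obtain ⟨k, σ, h₀, h⟩ := exists_bodyHolds 𝒯 s
  obtain ⟨s', hs⟩ := h.exists_matches
  obtain rfl := Sum.inr_injective (h₀.symm.trans hs.node)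
  refine ⟨k, σ, h, hs, hs.letter ▸ hρ, fun b => ?_⟩
  cases hx : k.childArgs b with
  | none => simp [hs.no_child b hx]
  | some x =>
    obtain ⟨t, ht, -⟩ := hs.child b x hx
    simp [ht]

variable {P : MonadicProgram (tdLanguage L w)}

theorem mem_leastFixpoint_up [Finite T] (hP : ∀ r, IsRule N mark name r → r ∈ P) {ρ : T → N.State}
    (hρ : ∀ s, N.RunAt 𝒯.tree (𝒯.letter Empty.elim) ρ s) (s : T) :
    (name (.up (ρ s)), .inr s) ∈ leastFixpoint P 𝒯.tdStructure := by
  refine RootedBinaryTree.bottomUp (𝒯 := 𝒯.tree)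
    (p := fun s => (name (.up (ρ s)), .inr s) ∈ leastFixpoint P 𝒯.tdStructure) (fun s ih => ?_) s
  obtain ⟨k, σ, h, hs, hc⟩ := exists_compatible (hρ s)
  have := mem_leastFixpoint (hP _ (.up hc)) (σ := σ) h (childStates_mem hs ih)
  rwa [← hs.node]

/-- Follows the run from the root, where the root rule starts; the `up` atoms needed at the children
are already derived by `mem_leastFixpoint_up`. -/
theorem mem_leastFixpoint_down [Finite T] (hP : ∀ r, IsRule N mark name r → r ∈ P)
    {ρ : T → N.State} (hρ : N.IsAccepting 𝒯.tree (𝒯.letter Empty.elim) ρ) (s : T) :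
    (name (.down (ρ s)), .inr s) ∈ leastFixpoint P 𝒯.tdStructure := by
  refine RootedBinaryTree.topDown (𝒯 := 𝒯.tree)
    (p := fun s => (name (.down (ρ s)), .inr s) ∈ leastFixpoint P 𝒯.tdStructure)
    ?_ (fun s b t ht ih => ?_) s
  · obtain ⟨k, σ, h, hs, -⟩ := exists_compatible (hρ.1 𝒯.tree.root)
    have := mem_leastFixpoint (hP _ (.root hρ.2)) (S := 𝒯.tdStructure) (σ := σ) ⟨?_, ?_⟩ ?_
    · rwa [← hs.node]
    · intro B hB
      simp only [rootRule, List.mem_cons, List.not_mem_nil, or_false] at hB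
      rcases hB with rfl | rfl
      · exact bagAtom_holds.2 ⟨_, hs.node, hs.pos⟩
      · exact rootAtom_holds.2 hs.node
    · simp [rootRule]
    · simp only [rootRule, List.mem_cons, List.not_mem_nil, or_false, forall_eq, hs.node]
      exact mem_leastFixpoint_up hP hρ.1 _
  · obtain ⟨k, σ, h, hs, hc⟩ := exists_compatible (hρ.1 s)
    have := mem_leastFixpoint (hP _ (.down hc (congrArg (Option.map ρ) ht))) (σ := σ) h ?_
    · rwa [← hs.childVar_eq ht]
    · intro x hx
      rcases List.mem_cons.1 hx with rfl | hx
      · rwa [hs.node]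
      · exact childStates_mem hs (fun _ t _ => mem_leastFixpoint_up hP hρ.1 t) x hx

theorem mem_leastFixpoint_answer_iff [Finite T] (hname : Function.Injective name)
    (hP : ∀ r, r ∈ P ↔ IsRule N mark name r) (d : A ⊕ T) :
    (name .answer, d) ∈ leastFixpoint P 𝒯.tdStructure ↔ Meaning N mark 𝒯 .answer d := by
  constructor
  · intro hd
    obtain ⟨p, hp, h⟩ := leastFixpoint_subset
      (I := {x | ∃ p, name p = x.1 ∧ Meaning N mark 𝒯 p x.2})
      (fun r hr σ hE hI => ((hP r).1 hr).sound hname hE hI) hd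
    exact hname hp ▸ h
  · rintro ⟨ρ, hρ, s, i, hi, rfl⟩
    obtain ⟨k, σ, -, hs, -⟩ := exists_compatible (hρ.1 s)
    have := mem_leastFixpoint ((hP _).2 (.answer hi)) (S := 𝒯.tdStructure) (σ := σ) ⟨?_, ?_⟩ ?_
    · rwa [← hs.pos]
    · simp only [answerRule, List.mem_cons, List.not_mem_nil, or_false, forall_eq]
      exact bagAtom_holds.2 ⟨_, hs.node, hs.pos⟩
    · simp [answerRule]
    · simp only [answerRule, List.mem_cons, List.not_mem_nil, or_false, forall_eq, hs.node]
      exact mem_leastFixpoint_down (fun r => (hP r).2) hρ s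

end Program

end MSODatalog

open MSODatalog
theorem mainTheorem1 (L : FirstOrder.Language.{0, 0}) [L.IsRelational]
    [Finite (Σ r, L.Relations r)] (w : ℕ) (hw : 1 ≤ w) (φ : UnaryQuery L) :
    ∃ (P : MonadicProgram (tdLanguage L w)) (p : ℕ),
      (∀ r ∈ P, r.IsSafe) ∧ IsQuasiGuarded P ∧
      ∀ (A T : Type) [Finite A] [Finite T] [L.Structure A]
        (𝒯 : NormalizedTreeDecomposition L w A T) (d : A ⊕ T),
        (p, d) ∈ leastFixpoint P 𝒯.tdStructure ↔ ∃ a : A, d = Sum.inl a ∧ φ.Holds a := by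
  obtain ⟨N, mark, hN, hφ⟩ := UnaryQuery.exists_treeAutomaton w φ
  obtain ⟨n, ⟨e⟩⟩ := Finite.exists_equiv_fin (Predicate N.State)
  set name : Predicate N.State → ℕ := fun p => e p
  have hname : Function.Injective name := Fin.val_injective.comp e.injective
  obtain ⟨P, hP⟩ : ∃ P : MonadicProgram (tdLanguage L w), ∀ r, r ∈ P ↔ IsRule N mark name r :=
    ⟨(finite_isRule N mark name).toFinset.toList, by simp⟩
  refine ⟨P, name .answer, fun r hr => ((hP r).1 hr).isSafe,
    fun r hr => ((hP r).1 hr).exists_guard, fun A T _ _ _ 𝒯 d => ?_⟩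
  rw [mem_leastFixpoint_answer_iff hname hP]
  constructor
  · rintro ⟨ρ, hρ, s, i, hi, rfl⟩
    exact ⟨_, rfl, (hφ ..).2 ⟨ρ, hρ, s, i, hi, rfl⟩⟩
  · rintro ⟨a, rfl, ha⟩
    obtain ⟨ρ, hρ, s, i, hi, rfl⟩ := (hφ A T 𝒯 a).1 ha
    exact ⟨ρ, hρ, s, i, hi, rfl⟩
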